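/- All graphs are simple, undirected and of arbitrary (finite or infinite) cardinality. For $r,d\in\mathbb N=\{0,1,2,\dots\}$, a \emph{tree model of $r$ labels and height $d$} for a graph $G$ is a pair $(\mathfrak t,S)$, where $\mathfrak t$ is a (possibly infinite) rooted tree of height $d$ (the maximal distance of a node from the root is $d$) whose nodes are labeled by elements of $\{1,\dots,r+1\}$, and $S\subseteq\{1,\dots,r\}^2\times\{1,\dots,d\}$, such that: every root-to-leaf path has length exactly $d$; $V(G)$ is the set of leaves of $\mathfrak t$ (up to a bijection); each leaf has a label in $\{1,\dots,r\}$ and each internal node has the label $r+1$; $(i,j,l)\in S$ if and only if $(j,i,l)\in S$; and for all $u,v\in V(G)$ with labels $i,j$ and at distance $2l$ in $\mathfrak t$, $\{u,v\}\in E(G)$ if and only if $(i,j,l)\in S$. Let $\mathrm{TM}_r(d)$ be the class of all graphs that have a tree model of $r$ labels and height $d$, and $\mathrm{TM}^{\mathrm{fin}}_r(d)$ the class of its finite members. $\mathrm{MSO}$ is monadic second-order logic over the vocabulary $\{E\}$ of graphs; the quantifier rank of a formula is the maximal number of nested quantifiers, first-order and second-order ones counted together. Write $G\equiv_{\mathrm{MSO}[m]}H$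 if $G$ and $H$ satisfy the same $\mathrm{MSO}$ sentences of quantifier rank at most $m$. A graph is \emph{$\mathrm{MSO}$-pseudo-finite relative to} a class $\mathcal C$ of finite graphs if it satisfies every $\mathrm{MSO}$ sentence that is true in all graphs of $\mathcal C$. Let $\mathsf{tower}(0,x)=x$ and $\mathsf{tower}(d+1,x)=2^{\mathsf{tower}(d,x)}$ for real $x$; $\log$ is to base $2$, and in the degenerate case $r=0$ (where $\mathrm{TM}_0(d)$ is empty) we read $\log 0$ as $0$. \textbf{Theorem.} There is a strictly increasing function $h:\mathbb N\to\mathbb N$ such that the following hold for all $d,r\in\mathbb N$. \begin{enumerate} \item For every $m\ge 1$ and every graph $G\in\mathrm{TM}_r(d)$ there is a finite induced subgraph $H$ of $G$ with $H\in\mathrm{TM}_r(d)$, $H\equiv_{\mathrm{MSO}[m]}G$ and $|H|\le\mathsf{tower}(d,\;h(d)\cdot m\cdot(m+\log r))$. \item For every $m\ge1$, the relation $\equiv_{\mathrm{MSO}[m]}$ has finitely many equivalence classes on $\mathrm{TM}_r(d)$, and their number is at most $\mathsf{tower}(d+1,\;h(d)\cdot m^2\cdot(\max\{1,\log r\})^2)$;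 in particular, for $r\ge2$ it is at most $\mathsf{tower}(d+1,\;h(d)\cdot m^2\cdot(\log r)^2)$. \item Every graph of $\mathrm{TM}_r(d)$ is $\mathrm{MSO}$-pseudo-finite relative to $\mathrm{TM}^{\mathrm{fin}}_r(d)$. \end{enumerate} -/

import Mathlib

universe u v

/-! ### Monadic second-order logic over graphs -/

/-- Formulas of monadic second-order logic in the vocabulary `{E}` of graphs, with free
first-order variables indexed by `Fin n` and free set variables indexed by `Fin k`
(de Bruijn levels: the quantifiers `ex` and `exSet` bind the last variable of their body).
Universal quantifiers and the remaining connectives are the usual abbreviations, which do not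
change the quantifier rank. -/
inductive MSOFormula : ℕ → ℕ → Type
  | falsum {n k : ℕ} : MSOFormula n k
  | eq {n k : ℕ} (i j : Fin n) : MSOFormula n k
  | adj {n k : ℕ} (i j : Fin n) : MSOFormula n k
  | mem {n k : ℕ} (i : Fin n) (X : Fin k) : MSOFormula n k
  | neg {n k : ℕ} (φ : MSOFormula n k) : MSOFormula n k
  | conj {n k : ℕ} (φ ψ : MSOFormula n k) : MSOFormula n k
  | ex {n k : ℕ} (φ : MSOFormula (n + 1) k) : MSOFormula n k
  | exSet {n k : ℕ} (φ : MSOFormula n (k + 1)) : MSOFormula n k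

/-- Quantifier rank: the maximal number of nested quantifiers, first-order and second-order
ones counted together. -/
def MSOFormula.rank : {n k : ℕ} → MSOFormula n k → ℕ
  | _, _, .falsum => 0
  | _, _, .eq _ _ => 0
  | _, _, .adj _ _ => 0
  | _, _, .mem _ _ => 0
  | _, _, .neg φ => φ.rank
  | _, _, .conj φ ψ => max φ.rank ψ.rank
  | _, _, .ex φ => φ.rank + 1
  | _, _, .exSet φ => φ.rank + 1

/-- Satisfaction of a formula in a graph; set variables range over all sets of vertices. -/
def MSOFormula.Realize {V : Type u} (G : SimpleGraph V) :
    {n k : ℕ} → MSOFormula n k → (Fin n → V) → (Fin k → Set V) → Prop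
  | _, _, .falsum, _, _ => False
  | _, _, .eq i j, x, _ => x i = x j
  | _, _, .adj i j, x, _ => G.Adj (x i) (x j)
  | _, _, .mem i X, x, A => x i ∈ A X
  | _, _, .neg φ, x, A => ¬ φ.Realize G x A
  | _, _, .conj φ ψ, x, A => φ.Realize G x A ∧ ψ.Realize G x A
  | n, _, .ex φ, x, A => ∃ a : V, φ.Realize G (Fin.snoc (α := fun _ : Fin (n + 1) => V) x a) A
  | _, k, .exSet φ, x, A =>
      ∃ B : Set V, φ.Realize G x (Fin.snoc (α := fun _ : Fin (k + 1) => Set V) A B)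

/-- MSO sentences: formulas without free variables. -/
abbrev MSOSentence : Type := MSOFormula 0 0

/-- The graph `G` is a model of the sentence `φ`. -/
def MSOModels {V : Type u} (G : SimpleGraph V) (φ : MSOSentence) : Prop :=
  φ.Realize G Fin.elim0 Fin.elim0

/-- `MSO[m]`-equivalence: agreement on all MSO sentences of quantifier rank at most `m`. -/
def MSOEquiv {V : Type u} {W : Type v} (m : ℕ) (G : SimpleGraph V) (H : SimpleGraph W) : Prop :=
  ∀ φ : MSOSentence, φ.rank ≤ m → (MSOModels G φ ↔ MSOModels H φ)

/-! ### Tree models -/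

/-- A rooted tree on the node set `T` whose nodes carry labels from a set of `p` labels.
The tree may be infinite. -/
structure LabeledRootedTree (p : ℕ) (T : Type u) where
  graph : SimpleGraph T
  isTree : graph.IsTree
  root : T
  label : T → Fin p

namespace LabeledRootedTree

variable {p : ℕ} {T : Type u} (t : LabeledRootedTree p T)

/-- Distance from the root. -/
noncomputable def depth (x : T) : ℕ := t.graph.dist t.root x

/-- `y` is a child of `x`. -/
def IsChild (x y : T) : Prop := t.graph.Adj x y ∧ t.depth y = t.depth x + 1

/-- A leaf is a node without children. -/
def IsLeaf (x : T) : Prop := ∀ y, ¬ t.IsChild x y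

/-- The tree has height exactly `d`: the maximal distance of a node from the root is `d`. -/
def HasHeight (d : ℕ) : Prop := (∀ x, t.depth x ≤ d) ∧ ∃ x, t.depth x = d

end LabeledRootedTree

/-- `(t, S)` is a tree model of `r` labels and height `d` for the graph `G`, where the vertices
of `G` are identified with the leaves of `t` by the bijection `leaf`. The labels `1, …, r` are
`Fin.castSucc i` for `i : Fin r`, and the label `r + 1` is `Fin.last r`. -/
structure IsTreeModel {V T : Type u} (r d : ℕ) (G : SimpleGraph V)
    (t : LabeledRootedTree (r + 1) T) (S : Set (Fin r × Fin r × ℕ))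
    (leaf : V ≃ {x : T // t.IsLeaf x}) : Prop where
  height : t.HasHeight d
  leaf_depth : ∀ x, t.IsLeaf x → t.depth x = d
  leaf_label : ∀ x, t.IsLeaf x → ∃ i : Fin r, t.label x = i.castSucc
  internal_label : ∀ x, ¬ t.IsLeaf x → t.label x = Fin.last r
  /-- The signature is a subset of `[r]² × [d]`. -/
  signature_range : ∀ i j l, (i, j, l) ∈ S → 1 ≤ l ∧ l ≤ d
  signature_symm : ∀ i j l, (i, j, l) ∈ S ↔ (j, i, l) ∈ S
  adj_iff : ∀ (a b : V) (i j : Fin r) (l : ℕ), t.label (leaf a) = i.castSucc →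
    t.label (leaf b) = j.castSucc → t.graph.dist (leaf a : T) (leaf b : T) = 2 * l →
    (G.Adj a b ↔ (i, j, l) ∈ S)

/-- Classes of (finite or infinite) graphs. -/
abbrev GraphClass : Type (u + 1) := ∀ V : Type u, SimpleGraph V → Prop

/-- The class `TM_r(d)` of all graphs that have a tree model of `r` labels and height `d`. -/
def TM (r d : ℕ) : GraphClass.{u} := fun V G =>
  ∃ (T : Type u) (t : LabeledRootedTree (r + 1) T) (S : Set (Fin r × Fin r × ℕ))
    (leaf : V ≃ {x : T // t.IsLeaf x}), IsTreeModel r d G t S leaf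

/-- The class of the finite graphs in `TM_r(d)`. -/
def TMFin (r d : ℕ) : GraphClass.{u} := fun V G => Finite V ∧ TM r d V G

/-! ### Pseudo-finiteness and the index of `MSO[m]`-equivalence -/

/-- The MSO theory of a class of graphs. -/
def MSOTheory (C : GraphClass.{u}) : Set MSOSentence :=
  {φ | ∀ (V : Type u) (G : SimpleGraph V), C V G → MSOModels G φ}

/-- `G` is MSO-pseudo-finite relative to the class `C` (of finite graphs): `G` is a model of
the MSO theory of `C`. -/
def MSOPseudoFinite {V : Type u} (G : SimpleGraph V) (C : GraphClass.{u}) : Prop :=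
  ∀ φ ∈ MSOTheory C, MSOModels G φ

/-- The members of a class of graphs. -/
abbrev GraphClass.Members (C : GraphClass.{u}) : Type (u + 1) :=
  {G : Σ V : Type u, SimpleGraph V // C G.1 G.2}

/-- `MSO[m]`-equivalence as an equivalence relation on the members of a class of graphs. -/
def msoSetoid (m : ℕ) (C : GraphClass.{u}) : Setoid C.Members where
  r G H := MSOEquiv m G.1.2 H.1.2
  iseqv :=
    { refl := fun _ _ _ => Iff.rfl
      symm := fun h φ hφ => (h φ hφ).symm
      trans := fun h₁ h₂ φ hφ => (h₁ φ hφ).trans (h₂ φ hφ) }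

/-- The set of `MSO[m]`-equivalence classes on `C`; its cardinality is the index. -/
abbrev MSOClasses (m : ℕ) (C : GraphClass.{u}) : Type (u + 1) := Quotient (msoSetoid m C)

/-- Towers of exponentials: `tower 0 x = x` and `tower (d + 1) x = 2 ^ tower d x`. -/
noncomputable def tower : ℕ → ℝ → ℝ
  | 0, x => x
  | d + 1, x => (2 : ℝ) ^ tower d x

/-!
The tree of a tree model matters only through the ultrametric that it induces on the vertices: the
height of the lowest common ancestor (`TM.exists_ultrametric`). Conversely the ancestors of a
nonempty set of leaves form a tree model of the induced subgraph (`TM.induce`). So it suffices to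
prune trees with colored leaves.

A tree with colored leaves has a *type*, defined by recursion on its height `d`: the type of a leaf
is its color, and the type of a larger tree records how many children of the root have each type,
counted up to a threshold. Pruning superfluous children keeps the type (`Shape.exists_pruning`).
In the Ehrenfeucht–Fraïssé game for monadic second-order logic, the label of a leaf and the sets and
points chosen so far (points being singletons) are stored in its color, for which `r * 2 ^ m` colors
suffice in a game with `m` moves on `r` labels. A move refines the coloring, and it can be answered
on another tree of the same type if the thresholds before the move exceed those after the move by a
factor of at least the number of types after the move (`Shape.exists_refinement`). This rests on the
pigeonhole principle `exists_imitation`: a large set has a label that occurs often, and it absorbs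
the elements that are not needed for the other labels. Since types with thresholds at least two
determine the ultrametric on marked points (`Shape.exists_pair_of_type_eq`), trees of the same type
yield equivalent graphs (`Shape.realize_iff_of_type_eq`).

If `N` bounds the number of types of height `d`, then thresholds of at most `2 * N ^ m` suffice at
that height. Hence there are at most `(2 * N ^ m + 1) ^ N` types of height `d + 1`, one exponential
more, and a pruned tree of height `d + 1` has at most `2 * N ^ (m + 1)` times as many leaves as one of
height `d`. This gives the tower bounds. The number of equivalence classes is at most the number of
graphs of the bounded size, and pseudo-finiteness is immediate from the finite equivalent subgraphs.
-/

/-! ### Ancestors and leaf distances in rooted trees -/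

/-- In an acyclic graph every path is a geodesic. -/
theorem SimpleGraph.IsAcyclic.dist_eq_length {V : Type*} {G : SimpleGraph V} (h : G.IsAcyclic)
    {a b : V} {p : G.Walk a b} (hp : p.IsPath) : G.dist a b = p.length := by
  obtain ⟨q, hq, hql⟩ := p.reachable.exists_path_of_dist
  have := (h.subsingleton_path a b).elim ⟨p, hp⟩ ⟨q, hq⟩
  rw [← hql, Subtype.mk.inj this]

/-- Connected induced subgraphs of a tree are isometrically embedded. -/
theorem SimpleGraph.IsAcyclic.dist_induce {V : Type*} {G : SimpleGraph V} (h : G.IsAcyclic)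
    {s : Set V} (hs : (G.induce s).Connected) (a b : s) :
    (G.induce s).dist a b = G.dist (a : V) b := by
  obtain ⟨q, hq, hql⟩ := hs.exists_path_of_dist a b
  have hq' : (q.map (SimpleGraph.Embedding.induce s).toHom).IsPath :=
    SimpleGraph.Walk.IsPath.map Subtype.val_injective hq
  have := h.dist_eq_length hq'
  rw [← hql, SimpleGraph.Walk.length_map] at *
  exact this.symm

namespace LabeledRootedTree

variable {p : ℕ} {T : Type u} (t : LabeledRootedTree p T)

theorem exists_parent (x : T) :
    ∃ y, (t.depth x ≠ 0 → t.graph.Adj y x) ∧ t.depth y = t.depth x - 1 := by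
  rcases Nat.eq_zero_or_pos (t.depth x) with h0 | h0
  · exact ⟨x, by simp [h0], by simp [h0]⟩
  obtain ⟨w, hw⟩ := t.isTree.connected.exists_walk_length_eq_dist x t.root
  cases w with
  | nil => simp [depth] at h0
  | @cons _ y _ hxy q =>
    refine ⟨y, fun _ => hxy.symm, ?_⟩
    have h1 : t.graph.dist t.root y ≤ q.length := by
      rw [SimpleGraph.dist_comm]; exact SimpleGraph.dist_le q
    have h2 := t.isTree.connected.dist_triangle (u := t.root) (v := y) (w := x)
    have h3 : t.graph.dist y x = 1 := SimpleGraph.dist_eq_one_iff_adj.mpr hxy.symm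
    rw [SimpleGraph.dist_comm, SimpleGraph.Walk.length_cons] at hw
    unfold depth
    omega

/-- The parent of a node; the root is its own parent. -/
noncomputable def parent (x : T) : T := (t.exists_parent x).choose

theorem parent_adj {x : T} (h : t.depth x ≠ 0) : t.graph.Adj (t.parent x) x :=
  (t.exists_parent x).choose_spec.1 h

theorem depth_parent (x : T) : t.depth (t.parent x) = t.depth x - 1 :=
  (t.exists_parent x).choose_spec.2

theorem depth_iterate_parent (x : T) (l : ℕ) : t.depth (t.parent^[l] x) = t.depth x - l := by
  induction l with
  | zero => rfl
  | succ l ih => rw [Function.iterate_succ_apply', depth_parent, ih]; omega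

theorem depth_eq_zero {x : T} : t.depth x = 0 ↔ x = t.root := by
  unfold depth
  rw [t.isTree.connected.dist_eq_zero_iff, eq_comm]

theorem iterate_parent_eq_root {x : T} {l : ℕ} (h : t.depth x ≤ l) :
    t.parent^[l] x = t.root := by
  rw [← depth_eq_zero, depth_iterate_parent]; omega

/-- The number of steps two nodes have to climb until they meet; for nodes of equal depth it is
half their distance. -/
noncomputable def meet (x y : T) : ℕ := sInf {l | t.parent^[l] x = t.parent^[l] y}

theorem meet_nonempty (x y : T) : {l | t.parent^[l] x = t.parent^[l] y}.Nonempty :=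
  ⟨max (t.depth x) (t.depth y), by
    rw [Set.mem_ofPred_eq, t.iterate_parent_eq_root (le_max_left _ _),
      t.iterate_parent_eq_root (le_max_right _ _)]⟩

theorem meet_le_iff {x y : T} {l : ℕ} :
    t.meet x y ≤ l ↔ t.parent^[l] x = t.parent^[l] y := by
  constructor
  · intro h
    have h1 : t.parent^[t.meet x y] x = t.parent^[t.meet x y] y := Nat.sInf_mem (t.meet_nonempty x y)
    obtain ⟨k, rfl⟩ := Nat.exists_eq_add_of_le' h
    rw [Function.iterate_add_apply, Function.iterate_add_apply, h1]
  · exact fun h => Nat.sInf_le h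

theorem meet_comm (x y : T) : t.meet x y = t.meet y x := by
  simp only [meet, eq_comm]

theorem meet_eq_zero {x y : T} : t.meet x y = 0 ↔ x = y := by
  rw [← Nat.le_zero, meet_le_iff]; rfl

theorem meet_triangle (x y z : T) : t.meet x z ≤ max (t.meet x y) (t.meet y z) := by
  rw [meet_le_iff, t.meet_le_iff.mp (le_max_left _ _), t.meet_le_iff.mp (le_max_right _ _)]

/-- The path through the lowest common ancestor. It does not go below the depth of its ends, so that
prolonging it at both ends yields a path again. -/
theorem exists_path_of_iterate_parent (l : ℕ) : ∀ x y : T, t.depth x = t.depth y →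
    l ≤ t.depth x → t.parent^[l] x = t.parent^[l] y →
    (∀ k < l, t.parent^[k] x ≠ t.parent^[k] y) →
    ∃ w : t.graph.Walk x y, w.IsPath ∧ w.length = 2 * l ∧
      ∀ z ∈ w.support, t.depth z ≤ t.depth x := by
  induction l with
  | zero =>
    intro x y _ _ h _
    obtain rfl : x = y := h
    exact ⟨.nil, by simp, rfl, by simp⟩
  | succ l ih =>
    intro x y hxy hl heq hne
    have hx : t.depth x ≠ 0 := by omega
    obtain ⟨w, hw, hwl, hwd⟩ := ih (t.parent x) (t.parent y)
      (by rw [depth_parent, depth_parent, hxy]) (by rw [depth_parent]; omega) heq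
      (fun k hk => hne (k + 1) (by omega))
    rw [depth_parent] at hwd
    have hxw : x ∉ w.support := fun h => by have := hwd _ h; omega
    have hyw : y ∉ w.support := fun h => by have := hwd _ h; omega
    have hxney : x ≠ y := hne 0 (by omega)
    refine ⟨.cons (t.parent_adj hx).symm (w.concat (t.parent_adj (hxy ▸ hx))), ?_, ?_, ?_⟩
    · rw [SimpleGraph.Walk.cons_isPath_iff, SimpleGraph.Walk.support_concat]
      refine ⟨hw.concat hyw _, ?_⟩
      simp [hxw, hxney]
    · simp [hwl]; omega
    · intro z hz
      simp only [SimpleGraph.Walk.support_cons, SimpleGraph.Walk.support_concat,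
        List.mem_cons, List.mem_append, List.not_mem_nil, or_false] at hz
      rcases hz with rfl | hz | rfl
      · exact le_rfl
      · have := hwd z hz; omega
      · omega

theorem dist_eq_two_mul_meet {x y : T} (h : t.depth x = t.depth y) :
    t.graph.dist x y = 2 * t.meet x y := by
  obtain ⟨w, hw, hl, -⟩ := t.exists_path_of_iterate_parent (t.meet x y) x y h
    (t.meet_le_iff.mpr (by
      rw [t.iterate_parent_eq_root le_rfl, t.iterate_parent_eq_root h.ge]))
    (t.meet_le_iff.mp le_rfl) (fun k hk he => absurd (t.meet_le_iff.mpr he) (by omega))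
  rw [t.isTree.isAcyclic.dist_eq_length hw, hl]

/-- The set of all ancestors of the nodes in `s`. -/
def ancestors (s : Set T) : Set T := {x | ∃ a ∈ s, ∃ l, t.parent^[l] a = x}

theorem subset_ancestors (s : Set T) : s ⊆ t.ancestors s := fun a ha => ⟨a, ha, 0, rfl⟩

theorem parent_mem_ancestors {s : Set T} {x : T} (h : x ∈ t.ancestors s) :
    t.parent x ∈ t.ancestors s := by
  obtain ⟨a, ha, l, rfl⟩ := h
  exact ⟨a, ha, l + 1, Function.iterate_succ_apply' _ _ _⟩

theorem root_mem_ancestors {s : Set T} (hs : s.Nonempty) : t.root ∈ t.ancestors s := by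
  obtain ⟨a, ha⟩ := hs
  exact ⟨a, ha, t.depth a, t.iterate_parent_eq_root le_rfl⟩

theorem ancestors_connected {s : Set T} (hs : s.Nonempty) :
    (t.graph.induce (t.ancestors s)).Connected := by
  have key : ∀ (n : ℕ) (x : t.ancestors s), t.depth x = n →
      (t.graph.induce (t.ancestors s)).Reachable x ⟨t.root, t.root_mem_ancestors hs⟩ := by
    intro n
    induction n with
    | zero =>
      intro x hx
      rw [depth_eq_zero] at hx
      rw [← show x = ⟨t.root, t.root_mem_ancestors hs⟩ from Subtype.ext hx]
    | succ n ih =>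
      intro x hx
      have h0 : t.depth x ≠ 0 := by omega
      have hadj : (t.graph.induce (t.ancestors s)).Adj x
          ⟨t.parent x, t.parent_mem_ancestors x.2⟩ := (t.parent_adj h0).symm
      exact hadj.reachable.trans (ih _ (by change t.depth (t.parent x) = n; rw [depth_parent]; omega))
  have : Nonempty (t.ancestors s) := ⟨⟨t.root, t.root_mem_ancestors hs⟩⟩
  exact ⟨fun x y => (key _ x rfl).trans (key _ y rfl).symm⟩

/-- The subtree formed by the ancestors of a nonempty set of nodes. -/
def restrict (s : Set T) (hs : s.Nonempty) : LabeledRootedTree p (t.ancestors s) where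
  graph := t.graph.induce (t.ancestors s)
  isTree := ⟨t.ancestors_connected hs, t.isTree.isAcyclic.induce _⟩
  root := ⟨t.root, t.root_mem_ancestors hs⟩
  label x := t.label x

variable {t}

theorem restrict_dist {s : Set T} (hs : s.Nonempty) (x y : t.ancestors s) :
    (t.restrict s hs).graph.dist x y = t.graph.dist (x : T) y :=
  t.isTree.isAcyclic.dist_induce (t.ancestors_connected hs) x y

theorem restrict_depth {s : Set T} (hs : s.Nonempty) (x : t.ancestors s) :
    (t.restrict s hs).depth x = t.depth x :=
  restrict_dist hs _ _

/-- A proper ancestor of a node of `s` has a child in the subtree. -/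
theorem restrict_isLeaf {s : Set T} (hs : s.Nonempty) (hleaf : ∀ x ∈ s, t.IsLeaf x)
    (x : t.ancestors s) : (t.restrict s hs).IsLeaf x ↔ (x : T) ∈ s := by
  constructor
  · intro hx
    obtain ⟨x, a, ha, l, rfl⟩ := x
    induction l with
    | zero => exact ha
    | succ l ih =>
      by_cases h0 : t.depth (t.parent^[l] a) = 0
      · -- this case concerns the root only, which is its own parent
        have h : t.parent^[l + 1] a = t.parent^[l] a := by
          rw [(t.depth_eq_zero).mp h0, ← t.depth_eq_zero, depth_iterate_parent]
          rw [depth_iterate_parent] at h0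
          omega
        simp only [h] at hx ⊢
        exact ih hx
      · refine absurd ⟨?_, ?_⟩ (hx ⟨t.parent^[l] a, a, ha, l, rfl⟩)
        · change t.graph.Adj (t.parent^[l + 1] a) (t.parent^[l] a)
          rw [Function.iterate_succ_apply']
          exact t.parent_adj h0
        · rw [restrict_depth, restrict_depth]
          change t.depth (t.parent^[l] a) = t.depth (t.parent^[l + 1] a) + 1
          rw [Function.iterate_succ_apply', depth_parent]
          omega
  · intro hx y hy
    refine hleaf x hx y ⟨hy.1, ?_⟩
    have := hy.2
    rwa [restrict_depth, restrict_depth] at this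

end LabeledRootedTree

/-- The class `TM r d` is closed under nonempty induced subgraphs. -/
theorem TM.induce {r d : ℕ} {V : Type u} {G : SimpleGraph V} (hG : TM r d V G) {s : Set V}
    (hs : s.Nonempty) : TM r d s (G.induce s) := by
  obtain ⟨T, t, S, leaf, h⟩ := hG
  set s' : Set T := (fun a => (leaf a : T)) '' s with hs'
  have hne : s'.Nonempty := hs.image _
  have hleaf : ∀ x ∈ s', t.IsLeaf x := by rintro _ ⟨a, -, rfl⟩; exact (leaf a).2
  have hmem (a : s) : (leaf a : T) ∈ s' := ⟨a, a.2, rfl⟩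
  let f : s → {x // (t.restrict s' hne).IsLeaf x} := fun a =>
    ⟨⟨leaf a, t.subset_ancestors _ (hmem a)⟩,
      (LabeledRootedTree.restrict_isLeaf hne hleaf _).mpr (hmem a)⟩
  have hf : f.Bijective := by
    constructor
    · intro a b hab
      have : (leaf a : T) = leaf b := congrArg (fun z => (z.1 : T)) hab
      exact Subtype.ext (leaf.injective (Subtype.ext this))
    · rintro ⟨x, hx⟩
      obtain ⟨a, ha, hax⟩ := (LabeledRootedTree.restrict_isLeaf hne hleaf _).mp hx
      exact ⟨⟨a, ha⟩, Subtype.ext (Subtype.ext hax)⟩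
  have hl (x : t.ancestors s') (hx : (t.restrict s' hne).IsLeaf x) : t.IsLeaf x :=
    hleaf x ((LabeledRootedTree.restrict_isLeaf hne hleaf x).mp hx)
  refine ⟨_, t.restrict s' hne, S, Equiv.ofBijective f hf, ?_⟩
  constructor
  · refine ⟨fun x => ?_, ?_⟩
    · rw [LabeledRootedTree.restrict_depth]; exact h.height.1 x
    · obtain ⟨a, ha⟩ := hs
      refine ⟨(f ⟨a, ha⟩).1, ?_⟩
      rw [LabeledRootedTree.restrict_depth]
      exact h.leaf_depth _ (leaf a).2
  · intro x hx
    rw [LabeledRootedTree.restrict_depth]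
    exact h.leaf_depth _ (hl x hx)
  · exact fun x hx => h.leaf_label _ (hl x hx)
  · intro x hx
    refine h.internal_label x fun hx' => hx fun y hy => hx' y ⟨hy.1, ?_⟩
    have := hy.2
    rwa [LabeledRootedTree.restrict_depth, LabeledRootedTree.restrict_depth] at this
  · exact h.signature_range
  · exact h.signature_symm
  · intro a b i j l hi hj hd
    rw [LabeledRootedTree.restrict_dist] at hd
    exact h.adj_iff a b i j l hi hj hd

/-- A tree model without its tree: all that matters about the tree is the ultrametric that it
induces on the vertices. -/
theorem TM.exists_ultrametric {r d : ℕ} {V : Type u} {G : SimpleGraph V} (hG : TM r d V G) :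
    ∃ (D : V → V → ℕ) (lab : V → Fin r) (S : Set (Fin r × Fin r × ℕ)),
      (∀ a b, D a b = 0 ↔ a = b) ∧ (∀ a b, D a b = D b a) ∧
      (∀ a b c, D a c ≤ max (D a b) (D b c)) ∧ (∀ a b, D a b ≤ d) ∧
      ∀ a b, G.Adj a b ↔ (lab a, lab b, D a b) ∈ S := by
  obtain ⟨T, t, S, leaf, h⟩ := hG
  have hdep (a : V) : t.depth (leaf a) = d := h.leaf_depth _ (leaf a).2
  choose lab hlab using fun a : V => h.leaf_label _ (leaf a).2
  refine ⟨fun a b => t.meet (leaf a) (leaf b), lab, S, ?_, ?_, ?_, ?_, ?_⟩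
  · intro a b
    rw [t.meet_eq_zero, Subtype.coe_inj, leaf.apply_eq_iff_eq]
  · exact fun a b => t.meet_comm _ _
  · exact fun a b c => t.meet_triangle _ _ _
  · intro a b
    rw [t.meet_le_iff, t.iterate_parent_eq_root (hdep a).le, t.iterate_parent_eq_root (hdep b).le]
  · intro a b
    exact h.adj_iff a b _ _ _ (hlab a) (hlab b)
      (t.dist_eq_two_mul_meet ((hdep a).trans (hdep b).symm))

theorem TM.nonempty {r d : ℕ} {V : Type u} {G : SimpleGraph V} (hG : TM r d V G) :
    Nonempty V := by
  obtain ⟨T, t, S, leaf, h⟩ := hG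
  obtain ⟨x, hx⟩ := h.height.2
  refine ⟨leaf.symm ⟨x, fun y hy => ?_⟩⟩
  have := h.height.1 y
  have := hy.2
  omega

/-! ### Cardinalities up to a threshold -/

/-- From a set with finitely many kinds of elements one can select at most `t` elements of each
kind, keeping all multiplicities up to the threshold `t`. -/
theorem exists_selection {A Y : Type*} [Finite Y] (f : A → Y) (t : ℕ) :
    ∃ A₀ : Set A, A₀.encard ≤ ((Nat.card Y * t : ℕ) : ℕ∞) ∧
      ∀ y, {a | a ∈ A₀ ∧ f a = y}.encard = min {a | f a = y}.encard t := by
  have := Fintype.ofFinite Y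
  choose F hF hFc using fun y =>
    Set.exists_subset_encard_eq (min_le_left {a | f a = y}.encard (t : ℕ∞))
  have hF' {y a} (h : a ∈ F y) : f a = y := hF y h
  refine ⟨⋃ y, F y, ?_, fun y => ?_⟩
  · refine (Set.encard_iUnion_le_of_fintype F).trans ?_
    refine (Finset.sum_le_sum (g := fun _ => (t : ℕ∞)) fun y _ => ?_).trans ?_
    · exact (hFc y).trans_le (min_le_right _ _)
    · simp
  · rw [← hFc y]
    congr 1
    ext a
    constructor
    · rintro ⟨ha, rfl⟩
      obtain ⟨y, hy⟩ := Set.mem_iUnion.mp ha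
      rwa [hF' hy]
    · exact fun ha => ⟨Set.mem_iUnion.mpr ⟨y, ha⟩, hF' ha⟩

/-- A pigeonhole principle. -/
theorem exists_large_fiber {A Y : Type*} [Finite Y] [Nonempty A] (f : A → Y) {t : ℕ} (ht : 1 ≤ t)
    (h : ((Nat.card Y * t : ℕ) : ℕ∞) ≤ ENat.card A) :
    ∃ y, (t : ℕ∞) ≤ {a | f a = y}.encard := by
  have := Fintype.ofFinite Y
  have : Nonempty Y := Nonempty.map f inferInstance
  by_contra! hlt
  have h1 : ENat.card A ≤ ∑ y, {a | f a = y}.encard := by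
    rw [← Set.encard_univ]
    refine le_trans (Set.encard_le_encard fun a _ => ?_) (Set.encard_iUnion_le_of_fintype _)
    exact Set.mem_iUnion.mpr ⟨f a, rfl⟩
  have h2 : ∑ y, {a | f a = y}.encard ≤ ∑ _y : Y, ((t - 1 : ℕ) : ℕ∞) := by
    refine Finset.sum_le_sum fun y _ => ?_
    have := hlt y
    obtain ⟨n, hn⟩ := ENat.ne_top_iff_exists.mp (ne_top_of_lt this)
    rw [← hn] at this ⊢
    norm_cast at this ⊢
    omega
  have h3 := h.trans (h1.trans h2)
  rw [Finset.sum_const, nsmul_eq_mul, Finset.card_univ, ← Nat.card_eq_fintype_card] at h3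
  norm_cast at h3
  have h4 := Nat.le_of_mul_le_mul_left h3 Nat.card_pos
  omega

/-- If two sets have equal cardinality up to a large threshold, then every labelling of the first
one by finitely many labels can be imitated on the second one, up to a smaller threshold. -/
theorem exists_imitation {A B Y : Type*} [Finite Y] (f : A → Y) {t T : ℕ} (ht : 1 ≤ t)
    (hT : 1 ≤ T) (htT : Nat.card Y * t ≤ T)
    (h : min (ENat.card A) T = min (ENat.card B) T) :
    ∃ g : B → Y, (∀ b, ∃ a, f a = g b) ∧
      ∀ y, min {a | f a = y}.encard (t : ℕ∞) = min {b | g b = y}.encard (t : ℕ∞) := by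
  classical
  rcases lt_or_ge (ENat.card A) (T : ℕ∞) with hA | hA
  · -- below the threshold there is a bijection
    rw [min_eq_left hA.le] at h
    have hAB : ENat.card A = ENat.card B := by
      rcases min_choice (ENat.card B) (T : ℕ∞) with h' | h'
      · rw [h, h']
      · rw [h, h'] at hA; exact absurd hA (lt_irrefl _)
    have hfA : Finite A := ENat.card_lt_top.mp (hA.trans (ENat.natCast_lt_top T))
    have hfB : Finite B := ENat.card_lt_top.mp (hAB ▸ hA.trans (ENat.natCast_lt_top T))
    rw [ENat.card_eq_coe_natCard, ENat.card_eq_coe_natCard] at hAB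
    obtain ⟨e⟩ : Nonempty (B ≃ A) := Finite.card_eq.mp (by exact_mod_cast hAB.symm)
    refine ⟨f ∘ e, fun b => ⟨e b, rfl⟩, fun y => ?_⟩
    have : {a | f a = y} = e '' {b | (f ∘ e) b = y} := by
      ext a
      constructor
      · exact fun ha => ⟨e.symm a, by simpa using ha, by simp⟩
      · rintro ⟨b, hb, rfl⟩
        exact hb
    rw [this, e.injective.encard_image]
  · -- above it, imitate a selection, and give the other elements a label that occurs often
    have hB : (T : ℕ∞) ≤ ENat.card B := by
      rw [min_eq_right hA] at h; exact h ▸ min_le_left _ _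
    have hneA : Nonempty A := (ENat.one_le_card_iff_nonempty A).mp
      (le_trans (by exact_mod_cast hT) hA)
    have hneB : Nonempty B := (ENat.one_le_card_iff_nonempty B).mp
      (le_trans (by exact_mod_cast hT) hB)
    have htT' : ((Nat.card Y * t : ℕ) : ℕ∞) ≤ T := by exact_mod_cast htT
    obtain ⟨y₀, hy₀⟩ := exists_large_fiber f ht (htT'.trans hA)
    obtain ⟨A₀, hA₀, hA₀f⟩ := exists_selection f t
    obtain ⟨ι, -, hι⟩ := Set.Finite.exists_injOn_of_encard_le (t := (Set.univ : Set B))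
      (Set.finite_of_encard_le_coe hA₀)
      (by rw [Set.encard_univ]; exact hA₀.trans (htT'.trans hB))
    let g : B → Y := fun b => if hb : ∃ a ∈ A₀, ι a = b then f hb.choose else y₀
    have hg {a} (ha : a ∈ A₀) : g (ι a) = f a := by
      have hb : ∃ a' ∈ A₀, ι a' = ι a := ⟨a, ha, rfl⟩
      change (if hb : ∃ a' ∈ A₀, ι a' = ι a then f hb.choose else y₀) = f a
      rw [dif_pos hb, hι hb.choose_spec.1 ha hb.choose_spec.2]
    have hg' {b} (hb : ¬ ∃ a ∈ A₀, ι a = b) : g b = y₀ := dif_neg hb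
    have hsub (y) : ι '' {a | a ∈ A₀ ∧ f a = y} ⊆ {b | g b = y} := by
      rintro _ ⟨a, ⟨ha, rfl⟩, rfl⟩
      exact hg ha
    have hcard (y) : (ι '' {a | a ∈ A₀ ∧ f a = y}).encard = min {a | f a = y}.encard t := by
      rw [Set.InjOn.encard_image (hι.mono fun a ha => ha.1), hA₀f]
    refine ⟨g, fun b => ?_, fun y => ?_⟩
    · by_cases hb : ∃ a ∈ A₀, ι a = b
      · obtain ⟨a, ha, rfl⟩ := hb
        exact ⟨a, (hg ha).symm⟩
      · rw [hg' hb]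
        have : {a | f a = y₀}.Nonempty := Set.one_le_encard_iff_nonempty.mp
          (le_trans (by exact_mod_cast ht) hy₀)
        exact this
    · by_cases hy : y = y₀
      · subst hy
        rw [min_eq_right hy₀, min_eq_right]
        have := Set.encard_le_encard (hsub y)
        rwa [hcard, min_eq_right hy₀] at this
      · have : {b | g b = y} = ι '' {a | a ∈ A₀ ∧ f a = y} := by
          refine Set.Subset.antisymm (fun b hb => ?_) (hsub y)
          by_cases hb' : ∃ a ∈ A₀, ι a = b
          · obtain ⟨a, ha, rfl⟩ := hb'
            exact ⟨a, ⟨ha, (hg ha).symm.trans hb⟩, rfl⟩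
          · exact absurd ((hg' hb').symm.trans hb).symm hy
        rw [this, hcard, min_assoc, min_self]

theorem min_add_eq_min_min_add_min {a b t : ℕ∞} : min (a + b) t = min (min a t + min b t) t := by
  rcases le_total a t with ha | ha <;> rcases le_total b t with hb | hb <;>
    simp only [min_eq_left, min_eq_right, ha, hb]
  · rw [min_eq_right (hb.trans le_add_self), min_eq_right le_add_self]
  · rw [min_eq_right (ha.trans le_self_add), min_eq_right le_self_add]
  · rw [min_eq_right (ha.trans le_self_add), min_eq_right le_self_add]

theorem Finset.min_sum_congr {X : Type*} (s : Finset X) {a b : X → ℕ∞} {t : ℕ∞}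
    (h : ∀ x ∈ s, min (a x) t = min (b x) t) : min (∑ x ∈ s, a x) t = min (∑ x ∈ s, b x) t := by
  classical
  induction s using Finset.induction_on with
  | empty => rfl
  | insert x s hx ih =>
    rw [Finset.sum_insert hx, Finset.sum_insert hx, min_add_eq_min_min_add_min,
      h x (Finset.mem_insert_self _ _), ih fun y hy => h y (Finset.mem_insert_of_mem hy),
      ← min_add_eq_min_min_add_min]

theorem encard_fiber_eq_sum {K X Y : Type*} [Fintype X] (k : K → X) (w : K → Y) (y : Y) :
    {i | w i = y}.encard = ∑ x, {i : {i // k i = x} | w i = y}.encard := by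
  have hU : {i | w i = y} =
      ⋃ x, (Subtype.val '' {i : {i // k i = x} | w i = y}) := by
    ext i
    simp
  rw [hU, Set.encard_iUnion_of_finite, finsum_eq_sum_of_fintype]
  · exact Finset.sum_congr rfl fun x _ => Subtype.val_injective.encard_image _
  · intro x x' hxx'
    rw [Function.onFun, Set.disjoint_left]
    rintro _ ⟨⟨i, hi⟩, -, rfl⟩ ⟨⟨i', hi'⟩, -, hii'⟩
    obtain rfl : i' = i := hii'
    exact hxx' (hi.symm.trans hi')

/-- Version of `exists_imitation` over a partition of both sets into finitely many kinds: the
imitation assigns to an element only labels that occur at elements of the same kind. -/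
theorem exists_imitation_of_kinds {I J X Y : Type*} [Finite X] [Finite Y] (κ : I → X) (κ' : J → X)
    (f : I → Y) {t T : ℕ} (ht : 1 ≤ t) (hT : 1 ≤ T) (htT : Nat.card Y * t ≤ T)
    (h : ∀ x, min {i | κ i = x}.encard (T : ℕ∞) = min {j | κ' j = x}.encard (T : ℕ∞)) :
    ∃ g : J → Y, (∀ j, ∃ i, κ i = κ' j ∧ f i = g j) ∧
      ∀ y, min {i | f i = y}.encard (t : ℕ∞) = min {j | g j = y}.encard (t : ℕ∞) := by
  have := Fintype.ofFinite X
  choose g hg hgc using fun x => exists_imitation (A := {i // κ i = x}) (B := {j // κ' j = x})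
    (fun i => f i) ht hT htT (h x)
  refine ⟨fun j => g (κ' j) ⟨j, rfl⟩, fun j => ?_, fun y => ?_⟩
  · obtain ⟨⟨i, hi⟩, hi'⟩ := hg (κ' j) ⟨j, rfl⟩
    exact ⟨i, hi, hi'⟩
  · rw [encard_fiber_eq_sum κ f, encard_fiber_eq_sum κ' (fun j => g (κ' j) ⟨j, rfl⟩)]
    refine Finset.min_sum_congr _ fun x _ => ?_
    have heq : {j : {j // κ' j = x} | g (κ' j) ⟨j, rfl⟩ = y} = {j | g x j = y} := by
      ext ⟨j, rfl⟩
      rfl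
    rw [heq]
    exact hgc x y

/-- Cardinality of a set, cut off at the threshold `t`. -/
noncomputable def Set.capped {A : Type*} (s : Set A) (t : ℕ) : Fin (t + 1) :=
  ⟨(min s.encard t).toNat, by
    have h : ((min s.encard t).toNat : ℕ∞) ≤ t :=
      (ENat.natCast_toNat_le_self _).trans (min_le_right _ _)
    exact Nat.lt_succ_of_le (by exact_mod_cast h)⟩

theorem Set.capped_eq_iff {A B : Type*} {s : Set A} {s' : Set B} {t : ℕ} :
    s.capped t = s'.capped t ↔ min s.encard (t : ℕ∞) = min s'.encard (t : ℕ∞) := by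
  have h (n : ℕ∞) : min n t ≠ ⊤ := ne_top_of_le_ne_top (ENat.natCast_ne_top t) (min_le_right _ _)
  rw [capped, capped, Fin.mk.injEq, ← Nat.cast_inj (R := ℕ∞), ENat.natCast_toNat (h _),
    ENat.natCast_toNat (h _)]

/-- Multiplicities up to a threshold of at least two determine which pairs of kinds occur at pairs
of distinct elements. -/
theorem exists_pair_of_capped {I J X : Type*} {κ : I → X} {κ' : J → X} {t : ℕ} (ht : 2 ≤ t)
    (h : ∀ x, {i | κ i = x}.capped t = {j | κ' j = x}.capped t) :
    (∀ i, ∃ j, κ' j = κ i) ∧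
      ∀ i₁ i₂, i₁ ≠ i₂ → ∃ j₁ j₂, j₁ ≠ j₂ ∧ κ' j₁ = κ i₁ ∧ κ' j₂ = κ i₂ := by
  have hle {x} {k : ℕ} (hk : k ≤ t) (hx : (k : ℕ∞) ≤ {i | κ i = x}.encard) :
      (k : ℕ∞) ≤ {j | κ' j = x}.encard := by
    have hk' : (k : ℕ∞) ≤ t := by exact_mod_cast hk
    have := le_min hx hk'
    rw [Set.capped_eq_iff.mp (h x)] at this
    exact this.trans (min_le_left _ _)
  have h1 (i) : ∃ j, κ' j = κ i := by
    have : ((1 : ℕ) : ℕ∞) ≤ {j | κ' j = κ i}.encard := hle (by omega)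
      (by rw [Nat.cast_one, Set.one_le_encard_iff_nonempty]; exact ⟨i, rfl⟩)
    rw [Nat.cast_one, Set.one_le_encard_iff_nonempty] at this
    exact this
  refine ⟨h1, fun i₁ i₂ hne => ?_⟩
  by_cases hκ : κ i₁ = κ i₂
  · have h2 : ((2 : ℕ) : ℕ∞) ≤ {j | κ' j = κ i₁}.encard := by
      refine hle ht ?_
      rw [Nat.cast_ofNat, ← Set.encard_pair hne]
      refine Set.encard_le_encard ?_
      rintro _ (rfl | rfl)
      · rfl
      · exact hκ.symm
    have h3 : (1 : ℕ∞) < {j | κ' j = κ i₁}.encard :=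
      lt_of_lt_of_le (by norm_num) h2
    obtain ⟨j₁, j₂, hj₁, hj₂, hj⟩ := Set.one_lt_encard_iff.mp h3
    exact ⟨j₁, j₂, hj, hj₁, hκ ▸ hj₂⟩
  · obtain ⟨j₁, hj₁⟩ := h1 i₁
    obtain ⟨j₂, hj₂⟩ := h1 i₂
    exact ⟨j₁, j₂, fun h => hκ (by rw [← hj₁, ← hj₂, h]), hj₁, hj₂⟩

/-! ### Shapes of trees and types of colored trees -/

/-- Rooted trees, given by their recursive structure, all of whose leaves have depth `d`. -/
inductive Shape : ℕ → Type (u + 1)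
  | leaf : Shape 0
  | node {d : ℕ} (I : Type u) (f : I → Shape d) : Shape (d + 1)

/-- The leaves of a shape. -/
def Shape.Leaves : {d : ℕ} → Shape.{u} d → Type u
  | _, .leaf => PUnit
  | _, .node I f => Σ i : I, (f i).Leaves

open Classical in
/-- Height of the lowest common ancestor of two leaves. -/
noncomputable def Shape.height : {d : ℕ} → (s : Shape.{u} d) → s.Leaves → s.Leaves → ℕ
  | _, .leaf, _, _ => 0
  | d + 1, .node _ f, x, y => if h : x.1 = y.1 then (f y.1).height (h ▸ x.2) y.2 else d + 1

/-- The possible types of shapes with leaves colored by `C`: the type of a single leaf is its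
color, and the type of a larger shape counts, for each type of shapes of the next smaller depth
`d`, the children of the root that have this type, up to the threshold `t d`. -/
def ShapeType (C : Type) (t : ℕ → ℕ) : ℕ → Type
  | 0 => C
  | d + 1 => ShapeType C t d → Fin (t d + 1)

/-- The type of a shape with colored leaves. -/
noncomputable def Shape.type {C : Type} (t : ℕ → ℕ) :
    {d : ℕ} → (s : Shape.{u} d) → (s.Leaves → C) → ShapeType C t d
  | _, .leaf, c => c PUnit.unit
  | d + 1, .node I f, c => fun τ => {i : I | (f i).type t (fun v => c ⟨i, v⟩) = τ}.capped (t d)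

namespace Shape

variable {d : ℕ}

theorem height_mk_same {I : Type u} {f : I → Shape.{u} d} (i : I) (v w : (f i).Leaves) :
    (node I f).height ⟨i, v⟩ ⟨i, w⟩ = (f i).height v w := by
  exact dif_pos rfl

theorem height_mk_of_ne {I : Type u} {f : I → Shape.{u} d} {i j : I} (h : i ≠ j)
    (v : (f i).Leaves) (w : (f j).Leaves) : (node I f).height ⟨i, v⟩ ⟨j, w⟩ = d + 1 := by
  exact dif_neg h

theorem height_eq_zero {s : Shape.{u} d} {x y : s.Leaves} : s.height x y = 0 ↔ x = y := by
  induction s with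
  | leaf => exact ⟨fun _ => rfl, fun _ => rfl⟩
  | node I f ih =>
    obtain ⟨i, v⟩ := x
    obtain ⟨j, w⟩ := y
    by_cases h : i = j
    · subst h
      rw [height_mk_same, ih]
      exact ⟨fun h => h ▸ rfl, fun h => eq_of_heq (Sigma.mk.inj h).2⟩
    · rw [height_mk_of_ne h]
      exact ⟨fun h' => absurd h' (by omega), fun h' => absurd (Sigma.mk.inj h').1 h⟩

theorem _root_.ShapeType.finite {C : Type} [Finite C] (t : ℕ → ℕ) (d : ℕ) :
    Finite (ShapeType C t d) := by
  induction d with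
  | zero => exact inferInstanceAs (Finite C)
  | succ d ih => exact inferInstanceAs (Finite (ShapeType C t d → Fin (t d + 1)))

theorem _root_.ShapeType.card_succ {C : Type} [Finite C] (t : ℕ → ℕ) (d : ℕ) :
    Nat.card (ShapeType C t (d + 1)) = (t d + 1) ^ Nat.card (ShapeType C t d) := by
  have := ShapeType.finite (C := C) t d
  rw [show ShapeType C t (d + 1) = (ShapeType C t d → Fin (t d + 1)) from rfl, Nat.card_fun,
    Nat.card_fin]

/-- Any ultrametric that takes natural numbers up to `d` as values on a nonempty set is the one of
a shape of depth `d`. -/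
theorem exists_equiv_of_ultrametric : ∀ (d : ℕ) (V : Type u) [Nonempty V] (D : V → V → ℕ),
    (∀ a b, D a b = 0 ↔ a = b) → (∀ a b, D a b = D b a) →
    (∀ a b c, D a c ≤ max (D a b) (D b c)) → (∀ a b, D a b ≤ d) →
    ∃ (s : Shape.{u} d) (e : s.Leaves ≃ V), ∀ x y, s.height x y = D (e x) (e y) := by
  intro d
  induction d with
  | zero =>
    intro V _ D h0 _ _ hd
    have : Subsingleton V := ⟨fun a b => (h0 a b).mp (Nat.le_zero.mp (hd a b))⟩
    have v : V := Classical.arbitrary V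
    refine ⟨leaf, ⟨fun _ => v, fun _ => PUnit.unit, fun _ => rfl, fun _ => Subsingleton.elim _ _⟩,
      fun x y => ?_⟩
    exact ((h0 _ _).mpr rfl).symm
  | succ d ih =>
    intro V _ D h0 hs ht hd
    let S : Setoid V :=
      { r := fun a b => D a b ≤ d
        iseqv :=
          { refl := fun a => by rw [(h0 a a).mpr rfl]; omega
            symm := fun {a b} h => by rwa [hs]
            trans := fun {a b c} h h' => (ht a b c).trans (max_le h h') } }
    have hS {a b} : (Quotient.mk S a = Quotient.mk S b) ↔ D a b ≤ d := Quotient.eq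
    have key (q : Quotient S) : ∃ (s : Shape.{u} d) (e : s.Leaves ≃ {v // Quotient.mk S v = q}),
        ∀ x y, s.height x y = D (e x) (e y) := by
      have : Nonempty {v // Quotient.mk S v = q} :=
        ⟨⟨q.out, Quotient.out_eq q⟩⟩
      refine ih {v // Quotient.mk S v = q} (fun a b => D a b) ?_ ?_ ?_ ?_
      · exact fun a b => (h0 _ _).trans Subtype.coe_inj
      · exact fun a b => hs _ _
      · exact fun a b c => ht _ _ _
      · exact fun a b => hS.mp (a.2.trans b.2.symm)
    choose f e he using key
    refine ⟨node (Quotient S) f,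
      (Equiv.sigmaCongrRight e).trans (Equiv.sigmaFiberEquiv (Quotient.mk S)), ?_⟩
    rintro ⟨i, v⟩ ⟨j, w⟩
    change _ = D (e i v) (e j w)
    by_cases h : i = j
    · subst h
      rw [height_mk_same, he]
    · rw [height_mk_of_ne h]
      refine le_antisymm (Nat.lt_of_not_le fun h' => h ?_) (hd _ _)
      rw [← (e i v).2, ← (e j w).2]
      exact hS.mpr h'

/-- A type with thresholds at least two determines which colors and distances pairs of leaves
have. -/
theorem exists_pair_of_type_eq {C : Type} {t : ℕ → ℕ} (ht : ∀ d, 2 ≤ t d)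
    {s s' : Shape.{u} d} {c : s.Leaves → C} {c' : s'.Leaves → C}
    (h : s.type t c = s'.type t c') (x₁ x₂ : s.Leaves) :
    ∃ y₁ y₂ : s'.Leaves, c' y₁ = c x₁ ∧ c' y₂ = c x₂ ∧ s'.height y₁ y₂ = s.height x₁ x₂ := by
  induction s with
  | leaf =>
    cases s'
    exact ⟨PUnit.unit, PUnit.unit, Eq.symm h, Eq.symm h, rfl⟩
  | @node d I f ih =>
    obtain _ | ⟨J, f'⟩ := s'
    have h' := exists_pair_of_capped (ht d) fun τ => congrFun h τ
    obtain ⟨i₁, v₁⟩ := x₁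
    obtain ⟨i₂, v₂⟩ := x₂
    by_cases hi : i₁ = i₂
    · subst hi
      obtain ⟨j, hj⟩ := h'.1 i₁
      obtain ⟨w₁, w₂, hw₁, hw₂, hw⟩ := ih i₁ hj.symm v₁ v₂
      exact ⟨⟨j, w₁⟩, ⟨j, w₂⟩, hw₁, hw₂, by rw [height_mk_same, height_mk_same, hw]⟩
    · obtain ⟨j₁, j₂, hj, hj₁, hj₂⟩ := h'.2 i₁ i₂ hi
      obtain ⟨w₁, -, hw₁, -⟩ := ih i₁ hj₁.symm v₁ v₁
      obtain ⟨w₂, -, hw₂, -⟩ := ih i₂ hj₂.symm v₂ v₂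
      exact ⟨⟨j₁, w₁⟩, ⟨j₂, w₂⟩, hw₁, hw₂, by rw [height_mk_of_ne hi, height_mk_of_ne hj]⟩

/-- The back-and-forth property of types. If two colored shapes have the same type for large
thresholds, then any refinement of the coloring of the first shape (along a map `π` that forgets
the refinement) can be answered by a refinement of the coloring of the second one such that the
types for small thresholds still agree. -/
theorem exists_refinement {C : Type} [Finite C] {t T : ℕ → ℕ} (ht : ∀ d, 1 ≤ t d)
    (hT : ∀ d, 1 ≤ T d) (htT : ∀ d, Nat.card (ShapeType C t d) * t d ≤ T d) (π : C → C)
    {s s' : Shape.{u} d} {c : s.Leaves → C} {c' : s'.Leaves → C}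
    (h : s.type T c = s'.type T c') (e : s.Leaves → C) (he : ∀ x, π (e x) = c x) :
    ∃ e' : s'.Leaves → C, (∀ x, π (e' x) = c' x) ∧ s.type t e = s'.type t e' := by
  induction s with
  | leaf =>
    cases s'
    exact ⟨e, fun x => (he x).trans h, rfl⟩
  | @node d I f ih =>
    obtain _ | ⟨J, f'⟩ := s'
    have := ShapeType.finite (C := C) t d
    have := ShapeType.finite (C := C) T d
    obtain ⟨g, hg, hgc⟩ := exists_imitation_of_kinds
      (fun i => (f i).type T fun v => c ⟨i, v⟩) (fun j => (f' j).type T fun v => c' ⟨j, v⟩)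
      (fun i => (f i).type t fun v => e ⟨i, v⟩) (ht d) (hT d) (htT d)
      fun τ => Set.capped_eq_iff.mp (congrFun h τ)
    have key (j : J) : ∃ e' : (f' j).Leaves → C,
        (∀ x, π (e' x) = c' ⟨j, x⟩) ∧ (f' j).type t e' = g j := by
      obtain ⟨i, hi, hi'⟩ := hg j
      obtain ⟨e', he', he''⟩ := ih i hi (fun v => e ⟨i, v⟩) fun v => he ⟨i, v⟩
      exact ⟨e', he', he''.symm.trans hi'⟩
    choose e' he' hee' using key
    refine ⟨fun x => e' x.1 x.2, fun x => he' x.1 x.2, funext fun τ => ?_⟩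
    refine Set.capped_eq_iff.mpr ((hgc τ).trans ?_)
    simp only [hee']

/-- A bound on the number of leaves of shapes that represent all types. -/
noncomputable def sizeBound (C : Type) (t : ℕ → ℕ) : ℕ → ℕ
  | 0 => 1
  | d + 1 => Nat.card (ShapeType C t d) * t d * sizeBound C t d

/-- Every colored shape can be pruned to one of bounded size and of the same type. -/
theorem exists_pruning {C : Type} [Finite C] (t : ℕ → ℕ) (s : Shape.{u} d) (c : s.Leaves → C) :
    ∃ (s' : Shape.{u} d) (ι : s'.Leaves → s.Leaves), Function.Injective ι ∧
      (∀ x y, s.height (ι x) (ι y) = s'.height x y) ∧ s'.type t (c ∘ ι) = s.type t c ∧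
      Finite s'.Leaves ∧ Nat.card s'.Leaves ≤ sizeBound C t d := by
  induction s with
  | leaf =>
    exact ⟨leaf, id, Function.injective_id, fun _ _ => rfl, rfl, inferInstanceAs (Finite PUnit),
      (Nat.card_unique (α := PUnit)).le⟩
  | @node d I f ih =>
    have := ShapeType.finite (C := C) t d
    choose f' ι hι hh ht hfin hcard using fun i => ih i fun v => c ⟨i, v⟩
    obtain ⟨J, hJ, hJc⟩ := exists_selection (fun i => (f i).type t fun v => c ⟨i, v⟩) (t d)
    have hJfin : Finite J := Set.finite_of_encard_le_coe hJ
    have hJ' : Nat.card J ≤ Nat.card (ShapeType C t d) * t d := by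
      rw [← Set.coe_ncard_eq_encard] at hJ
      exact_mod_cast hJ
    refine ⟨node J fun j => f' j, fun x => ⟨x.1, ι x.1 x.2⟩, ?_, ?_, ?_, ?_, ?_⟩
    · rintro ⟨i, v⟩ ⟨j, w⟩ hvw
      obtain rfl : i = j := Subtype.ext (Sigma.mk.inj hvw).1
      exact congrArg (Sigma.mk i) (hι i (eq_of_heq (Sigma.mk.inj hvw).2))
    · rintro ⟨i, v⟩ ⟨j, w⟩
      by_cases hij : i = j
      · subst hij
        rw [height_mk_same, height_mk_same, hh]
      · rw [height_mk_of_ne hij, height_mk_of_ne fun h => hij (Subtype.ext h)]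
    · funext τ
      refine Set.capped_eq_iff.mpr ?_
      have : {i : I | i ∈ J ∧ (f i).type t (fun v => c ⟨i, v⟩) = τ} =
          Subtype.val '' {j : J | (f' j).type t (fun v => c ⟨j, ι j v⟩) = τ} := by
        ext i
        constructor
        · exact fun hi => ⟨⟨i, hi.1⟩, (ht i).trans hi.2, rfl⟩
        · rintro ⟨j, hj, rfl⟩
          exact ⟨j.2, (ht j).symm.trans hj⟩
      have h1 := hJc τ
      rw [this, Subtype.val_injective.encard_image] at h1
      refine (congrArg (fun n => min n (t d : ℕ∞)) h1).trans ?_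
      rw [min_assoc, min_self]
    · exact inferInstanceAs (Finite (Σ j : J, (f' j).Leaves))
    · have := Fintype.ofFinite J
      change Nat.card (Σ j : J, (f' j).Leaves) ≤ _
      rw [Nat.card_sigma]
      refine (Finset.sum_le_card_nsmul (Finset.univ : Finset J) _ _ fun j _ => hcard j).trans ?_
      rw [smul_eq_mul, Finset.card_univ, ← Nat.card_eq_fintype_card]
      exact Nat.mul_le_mul_right _ hJ'

end Shape

/-! ### Types determine monadic second-order theories -/

/-- The coloring `c` assigns to each leaf its label under `lab` together with a set of bits, and
these bits mark the points `x` and the sets `A` of an assignment: the bit `β i`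
occurs only at `x i`, and the bit `γ i` occurs exactly on `A i`. The last `j` bits are not in
use. -/
structure IsMarking {L : Type u} {r m n k : ℕ} (lab : L → Fin r) (j : ℕ)
    (c : L → Fin r × Set (Fin m)) (β : Fin n → Fin m) (γ : Fin k → Fin m)
    (x : Fin n → L) (A : Fin k → Set L) : Prop where
  fst_eq : ∀ v, (c v).1 = lab v
  used : ∀ v, ∀ b ∈ (c v).2, (b : ℕ) + j < m
  used_point : ∀ i, (β i : ℕ) + j < m
  used_set : ∀ i, (γ i : ℕ) + j < m
  point_iff : ∀ i v, β i ∈ (c v).2 ↔ v = x i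
  set_iff : ∀ i v, γ i ∈ (c v).2 ↔ v ∈ A i

/-- The coloring `e` differs from `c` only in that the bit `q` marks the set `B`. -/
structure IsRemark {L : Type u} {r m : ℕ} (c e : L → Fin r × Set (Fin m)) (q : Fin m)
    (B : Set L) : Prop where
  fst_eq : ∀ v, (e v).1 = (c v).1
  mem_iff_of_ne : ∀ v b, b ≠ q → (b ∈ (e v).2 ↔ b ∈ (c v).2)
  mem_iff : ∀ v, q ∈ (e v).2 ↔ v ∈ B

namespace IsMarking

variable {L : Type u} {r m n k : ℕ} {lab : L → Fin r} {j : ℕ} {c e : L → Fin r × Set (Fin m)}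
  {β : Fin n → Fin m} {γ : Fin k → Fin m} {x : Fin n → L} {A : Fin k → Set L} {q : Fin m}
  {B : Set L}

theorem notMem (h : IsMarking lab (j + 1) c β γ x A) (hq : (q : ℕ) + (j + 1) = m) (v : L) :
    q ∉ (c v).2 := fun hv => by
  have := h.used v q hv
  omega

theorem ne_of_lt {b : Fin m} (hq : (q : ℕ) + (j + 1) = m) (hb : (b : ℕ) + (j + 1) < m) :
    b ≠ q := by
  rintro rfl
  omega

theorem used_remark (h : IsMarking lab (j + 1) c β γ x A) (hq : (q : ℕ) + (j + 1) = m)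
    (he : IsRemark c e q B) (v : L) (b : Fin m) (hb : b ∈ (e v).2) : (b : ℕ) + j < m := by
  by_cases hbq : b = q
  · subst hbq; omega
  · have := h.used v b ((he.mem_iff_of_ne v b hbq).mp hb)
    omega

theorem snoc_set (h : IsMarking lab (j + 1) c β γ x A) (hq : (q : ℕ) + (j + 1) = m)
    (he : IsRemark c e q B) :
    IsMarking lab j e β (Fin.snoc (α := fun _ => Fin m) γ q) x
      (Fin.snoc (α := fun _ => Set L) A B) where
  fst_eq v := (he.fst_eq v).trans (h.fst_eq v)
  used v b hb := h.used_remark hq he v b hb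
  used_point i := by have := h.used_point i; omega
  used_set i := by
    refine Fin.lastCases ?_ (fun i => ?_) i
    · rw [Fin.snoc_last]; omega
    · rw [Fin.snoc_castSucc]; have := h.used_set i; omega
  point_iff i v := by
    rw [he.mem_iff_of_ne v _ (ne_of_lt hq (h.used_point i)), h.point_iff]
  set_iff i v := by
    refine Fin.lastCases ?_ (fun i => ?_) i
    · rw [Fin.snoc_last, Fin.snoc_last, he.mem_iff]
    · rw [Fin.snoc_castSucc, Fin.snoc_castSucc,
        he.mem_iff_of_ne v _ (ne_of_lt hq (h.used_set i)), h.set_iff]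

theorem snoc_point (h : IsMarking lab (j + 1) c β γ x A) (hq : (q : ℕ) + (j + 1) = m) {a : L}
    (he : IsRemark c e q {a}) :
    IsMarking lab j e (Fin.snoc (α := fun _ => Fin m) β q) γ
      (Fin.snoc (α := fun _ => L) x a) A where
  fst_eq v := (he.fst_eq v).trans (h.fst_eq v)
  used v b hb := h.used_remark hq he v b hb
  used_point i := by
    refine Fin.lastCases ?_ (fun i => ?_) i
    · rw [Fin.snoc_last]; omega
    · rw [Fin.snoc_castSucc]; have := h.used_point i; omega
  used_set i := by have := h.used_set i; omega
  point_iff i v := by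
    refine Fin.lastCases ?_ (fun i => ?_) i
    · rw [Fin.snoc_last, Fin.snoc_last, he.mem_iff, Set.mem_singleton_iff]
    · rw [Fin.snoc_castSucc, Fin.snoc_castSucc,
        he.mem_iff_of_ne v _ (ne_of_lt hq (h.used_point i)), h.point_iff]
  set_iff i v := by
    rw [he.mem_iff_of_ne v _ (ne_of_lt hq (h.used_set i)), h.set_iff]

end IsMarking

namespace Shape

variable {r m d n k : ℕ} {s s' : Shape.{u} d} {c : s.Leaves → Fin r × Set (Fin m)}
  {c' : s'.Leaves → Fin r × Set (Fin m)}

/-- A set quantifier move of the game: it is stored in an unused bit `q`. -/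
theorem exists_remark {t T : ℕ → ℕ} (ht : ∀ d, 1 ≤ t d) (hT : ∀ d, 1 ≤ T d)
    (htT : ∀ d, Nat.card (ShapeType (Fin r × Set (Fin m)) t d) * t d ≤ T d)
    (h : s.type T c = s'.type T c') {q : Fin m} (hq : ∀ v, q ∉ (c v).2)
    (B : Set s.Leaves) :
    ∃ e e' B', IsRemark c e q B ∧ IsRemark c' e' q B' ∧ s.type t e = s'.type t e' := by
  classical
  -- forget the bit `q`, which does not occur in `c`
  let π : Fin r × Set (Fin m) → Fin r × Set (Fin m) := fun z => (z.1, z.2 \ {q})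
  let e : s.Leaves → Fin r × Set (Fin m) := fun v => ((c v).1, (c v).2 ∪ {b | b = q ∧ v ∈ B})
  have he (v) : π (e v) = c v := by
    refine Prod.ext rfl ?_
    ext b
    have : b ∈ (c v).2 → b ≠ q := fun hb hbq => hq v (hbq ▸ hb)
    simp only [π, e, Set.mem_sdiff, Set.mem_union, Set.mem_ofPred_eq, Set.mem_singleton_iff]
    tauto
  obtain ⟨e', he', hee'⟩ := exists_refinement ht hT htT π h e he
  refine ⟨e, e', {w | q ∈ (e' w).2}, ⟨fun _ => rfl, ?_, ?_⟩, ⟨?_, ?_, fun _ => Iff.rfl⟩, hee'⟩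
  · intro v b hb
    simp [e, hb]
  · intro v
    simp [e, hq v]
  · intro w
    rw [← he' w]
  · intro w b hb
    rw [← he' w]
    simp [π, hb]

/-- If a bit marks a singleton on one side, then it does so on the other side. -/
theorem exists_eq_singleton {t : ℕ → ℕ} (ht : ∀ d, 2 ≤ t d) (h : s.type t c = s'.type t c')
    {q : Fin m} {a : s.Leaves} (ha : ∀ v, q ∈ (c v).2 ↔ v = a) :
    ∃ b, ∀ w, q ∈ (c' w).2 ↔ w = b := by
  obtain ⟨b, -, hb, -⟩ := exists_pair_of_type_eq ht h a a
  have hqb : q ∈ (c' b).2 := by rw [hb, ha]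
  refine ⟨b, fun w => ⟨fun hw => ?_, fun hw => hw ▸ hqb⟩⟩
  obtain ⟨v₁, v₂, h₁, h₂, h₁₂⟩ := exists_pair_of_type_eq ht h.symm w b
  rw [← h₁, ha] at hw
  rw [← h₂, ha] at hqb
  rw [← height_eq_zero, ← h₁₂, height_eq_zero, hw, hqb]

/-- Marked points agree in their colors and distances. -/
theorem point_agree {t : ℕ → ℕ} (ht : ∀ d, 2 ≤ t d) (h : s.type t c = s'.type t c') {j : ℕ}
    {lab : s.Leaves → Fin r} {lab' : s'.Leaves → Fin r} {β : Fin n → Fin m} {γ : Fin k → Fin m}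
    {x : Fin n → s.Leaves} {A : Fin k → Set s.Leaves} {y : Fin n → s'.Leaves}
    {B : Fin k → Set s'.Leaves} (hc : IsMarking lab j c β γ x A)
    (hc' : IsMarking lab' j c' β γ y B) (i i' : Fin n) :
    c (x i) = c' (y i) ∧ s.height (x i) (x i') = s'.height (y i) (y i') := by
  obtain ⟨y₁, y₂, h₁, h₂, h₁₂⟩ := exists_pair_of_type_eq ht h (x i) (x i')
  have e₁ : y₁ = y i := by rw [← hc'.point_iff, h₁, hc.point_iff]
  have e₂ : y₂ = y i' := by rw [← hc'.point_iff, h₂, hc.point_iff]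
  rw [← e₁, ← e₂]
  exact ⟨h₁.symm, h₁₂.symm⟩

/-- Two colored shapes of the same type satisfy the same formulas: `exists_refinement` answers the
quantifiers, one bit of the colors being used up at each quantifier. -/
theorem realize_iff_of_type_eq {t : ℕ → ℕ → ℕ} (ht : ∀ j d, 2 ≤ t j d)
    (htt : ∀ j < m, ∀ d, Nat.card (ShapeType (Fin r × Set (Fin m)) (t j) d) * t j d ≤ t (j + 1) d)
    {lab : s.Leaves → Fin r} {lab' : s'.Leaves → Fin r} {S : Set (Fin r × Fin r × ℕ)}
    {G : SimpleGraph s.Leaves} {H : SimpleGraph s'.Leaves}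
    (hG : ∀ x y, G.Adj x y ↔ (lab x, lab y, s.height x y) ∈ S)
    (hH : ∀ x y, H.Adj x y ↔ (lab' x, lab' y, s'.height x y) ∈ S) (φ : MSOFormula n k) :
    ∀ {j : ℕ}, φ.rank ≤ j → j ≤ m → ∀ {c : s.Leaves → Fin r × Set (Fin m)}
      {c' : s'.Leaves → Fin r × Set (Fin m)}, s.type (t j) c = s'.type (t j) c' →
      ∀ {β : Fin n → Fin m} {γ : Fin k → Fin m} {x : Fin n → s.Leaves} {A : Fin k → Set s.Leaves}
      {y : Fin n → s'.Leaves} {B : Fin k → Set s'.Leaves}, IsMarking lab j c β γ x A →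
      IsMarking lab' j c' β γ y B → (φ.Realize G x A ↔ φ.Realize H y B) := by
  have ht1 (j d) : 1 ≤ t j d := one_le_two.trans (ht j d)
  induction φ with
  | falsum => intros; exact Iff.rfl
  | eq i i' =>
    intro j _ _ c c' h β γ x A y B hc hc'
    change x i = x i' ↔ y i = y i'
    rw [← height_eq_zero, ← height_eq_zero, (point_agree (ht j) h hc hc' i i').2]
  | adj i i' =>
    intro j _ _ c c' h β γ x A y B hc hc'
    change G.Adj _ _ ↔ H.Adj _ _
    rw [hG, hH, (point_agree (ht j) h hc hc' i i').2, ← hc.fst_eq, ← hc.fst_eq, ← hc'.fst_eq,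
      ← hc'.fst_eq, (point_agree (ht j) h hc hc' i i).1, (point_agree (ht j) h hc hc' i' i').1]
  | mem i X =>
    intro j _ _ c c' h β γ x A y B hc hc'
    change x i ∈ A X ↔ y i ∈ B X
    rw [← hc.set_iff, ← hc'.set_iff, (point_agree (ht j) h hc hc' i i).1]
  | neg φ ih =>
    intro j hj hjm c c' h β γ x A y B hc hc'
    exact not_congr (ih hj hjm h hc hc')
  | conj φ ψ ih₁ ih₂ =>
    intro j hj hjm c c' h β γ x A y B hc hc'
    exact and_congr (ih₁ ((le_max_left _ _).trans hj) hjm h hc hc')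
      (ih₂ ((le_max_right _ _).trans hj) hjm h hc hc')
  | ex φ ih =>
    intro j hj hjm c c' h β γ x A y B hc hc'
    obtain ⟨j, rfl⟩ : ∃ i, j = i + 1 :=
      Nat.exists_eq_succ_of_ne_zero (by rw [MSOFormula.rank] at hj; omega)
    have hj' : φ.rank ≤ j := Nat.le_of_succ_le_succ hj
    obtain ⟨q, hq⟩ : ∃ q : Fin m, (q : ℕ) + (j + 1) = m := ⟨⟨m - (j + 1), by omega⟩, by simp; omega⟩
    constructor
    · rintro ⟨a, ha⟩
      obtain ⟨e, e', B', he, he', hee'⟩ := exists_remark (ht1 j) (ht1 (j + 1)) (htt j (by omega)) h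
        (hc.notMem hq) {a}
      obtain ⟨b, hb⟩ := exists_eq_singleton (ht j) hee' he.mem_iff
      obtain rfl : B' = {b} := Set.ext fun w => (he'.mem_iff w).symm.trans (hb w)
      exact ⟨b, (ih hj' (by omega) hee' (hc.snoc_point hq he) (hc'.snoc_point hq he')).mp ha⟩
    · rintro ⟨a, ha⟩
      obtain ⟨e', e, B', he', he, hee'⟩ := exists_remark (ht1 j) (ht1 (j + 1)) (htt j (by omega))
        h.symm (hc'.notMem hq) {a}
      obtain ⟨b, hb⟩ := exists_eq_singleton (ht j) hee' he'.mem_iff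
      obtain rfl : B' = {b} := Set.ext fun w => (he.mem_iff w).symm.trans (hb w)
      exact ⟨b, (ih hj' (by omega) hee'.symm (hc.snoc_point hq he) (hc'.snoc_point hq he')).mpr ha⟩
  | exSet φ ih =>
    intro j hj hjm c c' h β γ x A y B hc hc'
    obtain ⟨j, rfl⟩ : ∃ i, j = i + 1 :=
      Nat.exists_eq_succ_of_ne_zero (by rw [MSOFormula.rank] at hj; omega)
    have hj' : φ.rank ≤ j := Nat.le_of_succ_le_succ hj
    obtain ⟨q, hq⟩ : ∃ q : Fin m, (q : ℕ) + (j + 1) = m := ⟨⟨m - (j + 1), by omega⟩, by simp; omega⟩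
    constructor
    · rintro ⟨D, hD⟩
      obtain ⟨e, e', B', he, he', hee'⟩ := exists_remark (ht1 j) (ht1 (j + 1)) (htt j (by omega)) h
        (hc.notMem hq) D
      exact ⟨B', (ih hj' (by omega) hee' (hc.snoc_set hq he) (hc'.snoc_set hq he')).mp hD⟩
    · rintro ⟨D, hD⟩
      obtain ⟨e', e, B', he', he, hee'⟩ := exists_remark (ht1 j) (ht1 (j + 1)) (htt j (by omega))
        h.symm (hc'.notMem hq) D
      exact ⟨B', (ih hj' (by omega) hee'.symm (hc.snoc_set hq he) (hc'.snoc_set hq he')).mpr hD⟩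

end Shape

/-! ### Isomorphism invariance -/

theorem MSOFormula.realize_iff_of_iso {V : Type u} {W : Type v} {G : SimpleGraph V}
    {H : SimpleGraph W} (f : G ≃g H) {n k : ℕ} (φ : MSOFormula n k) :
    ∀ (x : Fin n → V) (A : Fin k → Set V) (y : Fin n → W) (B : Fin k → Set W),
      (∀ i, y i = f (x i)) → (∀ i a, f a ∈ B i ↔ a ∈ A i) →
      (φ.Realize G x A ↔ φ.Realize H y B) := by
  induction φ with
  | falsum => intros; exact Iff.rfl
  | eq i j =>
    intro x A y B hx hA
    change x i = x j ↔ y i = y j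
    rw [hx, hx, f.injective.eq_iff]
  | adj i j =>
    intro x A y B hx hA
    change G.Adj _ _ ↔ H.Adj _ _
    rw [hx, hx, f.map_adj_iff]
  | mem i X =>
    intro x A y B hx hA
    change x i ∈ A X ↔ y i ∈ B X
    rw [hx, hA]
  | neg φ ih =>
    intro x A y B hx hA
    exact not_congr (ih x A y B hx hA)
  | conj φ ψ ih₁ ih₂ =>
    intro x A y B hx hA
    exact and_congr (ih₁ x A y B hx hA) (ih₂ x A y B hx hA)
  | ex φ ih =>
    intro x A y B hx hA
    have key (a : V) := ih (Fin.snoc (α := fun _ => V) x a) A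
      (Fin.snoc (α := fun _ => W) y (f a)) B
      (fun i => Fin.lastCases (by simp) (fun i => by simp [hx]) i) hA
    constructor
    · rintro ⟨a, ha⟩
      exact ⟨f a, (key a).mp ha⟩
    · rintro ⟨b, hb⟩
      obtain ⟨a, rfl⟩ := f.surjective b
      exact ⟨a, (key a).mpr hb⟩
  | exSet φ ih =>
    intro x A y B hx hA
    have key (D : Set V) (D' : Set W) (hD : ∀ a, f a ∈ D' ↔ a ∈ D) :=
      ih x (Fin.snoc (α := fun _ => Set V) A D) y (Fin.snoc (α := fun _ => Set W) B D') hx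
      (fun i => Fin.lastCases (by simpa using hD) (fun i => by simpa using hA i) i)
    constructor
    · rintro ⟨D, hD⟩
      exact ⟨f '' D, (key D _ fun a => f.injective.mem_set_image).mp hD⟩
    · rintro ⟨D, hD⟩
      exact ⟨f ⁻¹' D, (key _ D fun a => Iff.rfl).mpr hD⟩

theorem MSOEquiv.of_iso {V : Type u} {W : Type v} {G : SimpleGraph V} {H : SimpleGraph W}
    (f : G ≃g H) (m : ℕ) : MSOEquiv m G H := fun φ _ =>
  φ.realize_iff_of_iso f _ _ _ _ (fun i => i.elim0) (fun i => i.elim0)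

/-! ### Finite equivalent subgraphs -/

/-- A bound on the number of types of depth `d` over `K` colors for games with `m` moves. -/
def typeBound (K m : ℕ) : ℕ → ℕ
  | 0 => K
  | d + 1 => (2 * typeBound K m d ^ m + 1) ^ typeBound K m d

/-- The thresholds for types with `j` remaining moves. The factor `2` lets types see whether a set
is a singleton; the other factors satisfy the hypothesis of `Shape.exists_refinement`. -/
def threshold (K m j d : ℕ) : ℕ := 2 * typeBound K m d ^ j

section Bounds

variable {K m : ℕ}

theorem le_typeBound {k : ℕ} (hk : k ≤ 2) (hK : k ≤ K) (d : ℕ) : k ≤ typeBound K m d := by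
  induction d with
  | zero => exact hK
  | succ d ih =>
    rcases Nat.eq_zero_or_pos k with rfl | hk0
    · exact Nat.zero_le _
    have h1 : 1 ≤ typeBound K m d ^ m := Nat.one_le_pow _ _ (hk0.trans_le ih)
    refine hk.trans ?_
    calc 2 ≤ 2 * typeBound K m d ^ m + 1 := by omega
      _ ≤ typeBound K m (d + 1) := Nat.le_self_pow (by omega) _

theorem card_shapeType_le {C : Type} [Finite C] [Nonempty C] {j : ℕ} (hj : j ≤ m) (d : ℕ) :
    Nat.card (ShapeType C (threshold (Nat.card C) m j) d) ≤ typeBound (Nat.card C) m d := by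
  have h1 (d) : 1 ≤ typeBound (Nat.card C) m d := le_typeBound one_le_two Nat.card_pos d
  induction d with
  | zero => exact le_rfl
  | succ d ih =>
    rw [ShapeType.card_succ, threshold, typeBound]
    gcongr
    · omega
    · exact h1 d

theorem card_shapeType_mul_threshold_le {C : Type} [Finite C] [Nonempty C] {j : ℕ} (hj : j ≤ m)
    (d : ℕ) : Nat.card (ShapeType C (threshold (Nat.card C) m j) d) * threshold (Nat.card C) m j d
      ≤ threshold (Nat.card C) m (j + 1) d := by
  refine (Nat.mul_le_mul_right _ (card_shapeType_le hj d)).trans_eq ?_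
  simp only [threshold]
  ring

end Bounds

/-- The bound on the size of finite induced subgraphs that are equivalent up to rank `m`. -/
noncomputable def graphBound (r m d : ℕ) : ℕ :=
  Shape.sizeBound (Fin r × Set (Fin m)) (threshold (Nat.card (Fin r × Set (Fin m))) m m) d

theorem TM.pos {r d : ℕ} {V : Type u} {G : SimpleGraph V} (hG : TM r d V G) : 0 < r := by
  obtain ⟨v⟩ := hG.nonempty
  obtain ⟨-, lab, -⟩ := hG.exists_ultrametric
  exact Fin.pos (lab v)

/-- Pruning the tree of a tree model yields a finite equivalent induced subgraph. -/
theorem TM.exists_finite_msoEquiv {r d : ℕ} {V : Type u} {G : SimpleGraph V} (hG : TM r d V G)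
    (m : ℕ) : ∃ s : Set V, s.Finite ∧ s.Nonempty ∧ MSOEquiv m (G.induce s) G ∧
      s.ncard ≤ graphBound r m d := by
  have hne := hG.nonempty
  have : Nonempty (Fin r) := ⟨⟨0, hG.pos⟩⟩
  obtain ⟨D, lab, S, h0, hs, ht, hd, hadj⟩ := hG.exists_ultrametric
  obtain ⟨T, e, he⟩ := Shape.exists_equiv_of_ultrametric d V D h0 hs ht hd
  let c : T.Leaves → Fin r × Set (Fin m) := fun x => (lab (e x), ∅)
  obtain ⟨T', ι, hι, hh, hty, hfin, hcard⟩ :=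
    T.exists_pruning (threshold (Nat.card (Fin r × Set (Fin m))) m m) c
  have ht2 (j d) : 2 ≤ threshold (Nat.card (Fin r × Set (Fin m))) m j d :=
    Nat.le_mul_of_pos_right _ (pow_pos (le_typeBound one_le_two Nat.card_pos d) _)
  have hinj : Function.Injective (e ∘ ι) := e.injective.comp hι
  let f : T'.Leaves ≃ Set.range (e ∘ ι) := Equiv.ofInjective _ hinj
  refine ⟨Set.range (e ∘ ι), Set.finite_range _, ?_, ?_, ?_⟩
  · obtain ⟨v⟩ := hne
    obtain ⟨y, -⟩ := Shape.exists_pair_of_type_eq (ht2 m) hty.symm (e.symm v) (e.symm v)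
    exact ⟨_, y, rfl⟩
  · intro φ hφ
    let iso : G.comap (e ∘ ι) ≃g G.induce (Set.range (e ∘ ι)) := ⟨f, Iff.rfl⟩
    rw [← MSOEquiv.of_iso iso m φ hφ, ← MSOEquiv.of_iso (SimpleGraph.Iso.comap e G) m φ hφ]
    refine Shape.realize_iff_of_type_eq ht2
      (fun j hj d => card_shapeType_mul_threshold_le hj.le d) (lab := lab ∘ e ∘ ι)
      (lab' := lab ∘ e) (S := S) ?_ ?_ φ hφ le_rfl hty (β := Fin.elim0) (γ := Fin.elim0) ?_ ?_
    · intro x y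
      rw [← hh, he]
      exact hadj _ _
    · intro x y
      rw [he]
      exact hadj _ _
    · exact ⟨fun _ => rfl, fun v b hb => hb.elim, fun i => i.elim0, fun i => i.elim0,
        fun i => i.elim0, fun i => i.elim0⟩
    · exact ⟨fun _ => rfl, fun v b hb => hb.elim, fun i => i.elim0, fun i => i.elim0,
        fun i => i.elim0, fun i => i.elim0⟩
  · rw [← Nat.card_coe_set_eq, ← Nat.card_congr f]
    exact hcard

/-! ### Numerical bounds -/

theorem tower_mono (d : ℕ) : Monotone (tower d) := by
  induction d with
  | zero => exact fun _ _ h => h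
  | succ d ih => exact fun x y h => Real.rpow_le_rpow_of_exponent_le one_le_two (ih h)

theorem one_le_tower (d : ℕ) {x : ℝ} (hx : 1 ≤ x) : 1 ≤ tower d x := by
  induction d with
  | zero => exact hx
  | succ d ih => exact Real.one_le_rpow one_le_two (zero_le_one.trans ih)

theorem two_mul_tower_le (d : ℕ) {x : ℝ} (hx : 1 ≤ x) : 2 * tower d x ≤ tower d (2 * x) := by
  induction d with
  | zero => exact le_rfl
  | succ d ih =>
    calc 2 * (2 : ℝ) ^ tower d x = 2 ^ (tower d x + 1) := by
          rw [Real.rpow_add two_pos, Real.rpow_one, mul_comm]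
      _ ≤ 2 ^ tower d (2 * x) := Real.rpow_le_rpow_of_exponent_le one_le_two (by
          linarith [one_le_tower d hx])

theorem tower_succ_sq_le (d : ℕ) {x : ℝ} (hx : 1 ≤ x) :
    tower (d + 1) x ^ 2 ≤ tower (d + 1) (2 * x) := by
  calc ((2 : ℝ) ^ tower d x) ^ 2 = 2 ^ (2 * tower d x) := by
        rw [← Real.rpow_natCast, ← Real.rpow_mul two_pos.le, mul_comm, Nat.cast_ofNat]
    _ ≤ 2 ^ tower d (2 * x) := Real.rpow_le_rpow_of_exponent_le one_le_two (two_mul_tower_le d hx)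

theorem tower_le_tower_succ (d : ℕ) {x : ℝ} (hx : 1 ≤ x) : tower d x ≤ tower (d + 1) x := by
  induction d with
  | zero =>
    have h := one_add_mul_self_le_rpow_one_add (s := 1) (by norm_num) hx
    rw [mul_one, one_add_one_eq_two] at h
    change x ≤ (2 : ℝ) ^ x
    linarith
  | succ d ih => exact Real.rpow_le_rpow_of_exponent_le one_le_two ih

/-- The recursion of `typeBound` costs one exponential. The quantity `2 * N ^ (m + 1)` bounds the
number of types as well as the branching of pruned trees. -/
theorem two_mul_typeBound_succ_pow_le {K m : ℕ} (hK : 2 ≤ K) (d : ℕ) :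
    2 * typeBound K m (d + 1) ^ (m + 1) ≤ 2 ^ (2 * typeBound K m d ^ (m + 1)) ^ 4 := by
  rw [typeBound]
  have hN : 2 ≤ typeBound K m d := le_typeBound le_rfl hK d
  generalize typeBound K m d = N at hN
  set Q := 2 * N ^ (m + 1) with hQ
  have hNm : 1 ≤ N ^ m := Nat.one_le_pow _ _ (by omega)
  have h1 : 2 * N ^ m + 1 ≤ Q := by
    have : N ^ m * 2 ≤ N ^ m * N := Nat.mul_le_mul_left _ hN
    rw [hQ, pow_succ]; omega
  have h2 : N ≤ Q := by
    have : N ≤ N ^ (m + 1) := Nat.le_self_pow (by omega) N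
    omega
  have h3 : m + 1 ≤ Q := by
    have : m + 1 < 2 ^ (m + 1) := Nat.lt_two_pow_self
    have : 2 ^ (m + 1) ≤ N ^ (m + 1) := Nat.pow_le_pow_left hN _
    omega
  have hQ1 : 1 ≤ Q := by omega
  calc 2 * ((2 * N ^ m + 1) ^ N) ^ (m + 1) ≤ 2 * (Q ^ Q) ^ Q :=
        Nat.mul_le_mul_left _ (pow_le_pow
          ((Nat.pow_le_pow_left h1 N).trans (Nat.pow_le_pow_right hQ1 h2)) (Nat.pow_pos hQ1) h3)
    _ ≤ 2 * ((2 ^ Q) ^ Q) ^ Q := by gcongr; exact Nat.lt_two_pow_self.le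
    _ = 2 ^ (Q * Q * Q + 1) := by rw [← pow_mul, ← pow_mul, pow_succ', mul_assoc Q Q Q]
    _ ≤ 2 ^ Q ^ 4 := by
      gcongr
      · norm_num
      · have hQ2 : 2 ≤ Q := by omega
        have hQ3 : 1 ≤ Q * Q * Q := Nat.mul_pos (Nat.mul_pos hQ1 hQ1) hQ1
        calc Q * Q * Q + 1 ≤ Q * Q * Q * 2 := by omega
          _ ≤ Q * Q * Q * Q := Nat.mul_le_mul_left _ hQ2
          _ = Q ^ 4 := by ring

section

variable {r m : ℕ}

theorem one_le_rank_mul (hr : 1 ≤ r) (hm : 1 ≤ m) : 1 ≤ (m : ℝ) * (m + Real.logb 2 r) := by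
  have h1 : (1 : ℝ) ≤ m := by exact_mod_cast hm
  have h2 : 0 ≤ Real.logb 2 r := Real.logb_nonneg one_lt_two (by exact_mod_cast hr)
  nlinarith

theorem two_mul_typeBound_pow_le (hr : 1 ≤ r) (hm : 1 ≤ m) (d : ℕ) :
    ((2 * typeBound (r * 2 ^ m) m d ^ (m + 1) : ℕ) : ℝ) ≤
      tower (d + 1) (3 * 4 ^ d * (m * (m + Real.logb 2 r))) := by
  have hX := one_le_rank_mul hr hm
  induction d with
  | zero =>
    have hr0 : (0 : ℝ) < r := by exact_mod_cast hr
    have hK : ((r * 2 ^ m : ℕ) : ℝ) = 2 ^ ((m : ℝ) + Real.logb 2 r) := by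
      rw [Real.rpow_add two_pos, Real.rpow_natCast, Real.rpow_logb two_pos (by norm_num) hr0]
      push_cast
      ring
    have hl : 0 ≤ Real.logb 2 r := Real.logb_nonneg one_lt_two (by exact_mod_cast hr)
    have h1 : (1 : ℝ) ≤ m := by exact_mod_cast hm
    change _ ≤ (2 : ℝ) ^ (3 * 4 ^ 0 * (m * (m + Real.logb 2 r)))
    rw [typeBound, Nat.cast_mul, Nat.cast_pow, hK, ← Real.rpow_natCast, ← Real.rpow_mul two_pos.le,
      Nat.cast_ofNat]
    calc (2 : ℝ) * 2 ^ (((m : ℝ) + Real.logb 2 r) * ((m + 1 : ℕ) : ℝ))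
        = 2 ^ (((m : ℝ) + Real.logb 2 r) * ((m + 1 : ℕ) : ℝ) + 1) := by
          rw [Real.rpow_add two_pos, Real.rpow_one, mul_comm]
      _ ≤ _ := by
          refine Real.rpow_le_rpow_of_exponent_le one_le_two ?_
          push_cast
          nlinarith
  | succ d ih =>
    have h4 : (1 : ℝ) ≤ 4 ^ d := one_le_pow₀ (by norm_num)
    set y : ℝ := 3 * 4 ^ d * (m * (m + Real.logb 2 r)) with hy
    have hy1 : 1 ≤ y := by nlinarith
    have hK : 2 ≤ r * 2 ^ m := by
      calc 2 = 1 * 2 ^ 1 := rfl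
        _ ≤ r * 2 ^ m := Nat.mul_le_mul hr (Nat.pow_le_pow_right two_pos hm)
    calc ((2 * typeBound (r * 2 ^ m) m (d + 1) ^ (m + 1) : ℕ) : ℝ)
        ≤ ((2 ^ (2 * typeBound (r * 2 ^ m) m d ^ (m + 1)) ^ 4 : ℕ) : ℝ) := by
          exact_mod_cast two_mul_typeBound_succ_pow_le hK d
      _ = 2 ^ (((2 * typeBound (r * 2 ^ m) m d ^ (m + 1) : ℕ) : ℝ) ^ 4) := by
          rw [← Nat.cast_pow, Real.rpow_natCast]; norm_cast
      _ ≤ 2 ^ (tower (d + 1) y ^ 4) := by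
          refine Real.rpow_le_rpow_of_exponent_le one_le_two ?_
          gcongr
      _ = 2 ^ ((tower (d + 1) y ^ 2) ^ 2) := by rw [← pow_mul]
      _ ≤ 2 ^ (tower (d + 1) (2 * y) ^ 2) := by
          refine Real.rpow_le_rpow_of_exponent_le one_le_two ?_
          have := one_le_tower (d + 1) hy1
          gcongr
          exact tower_succ_sq_le d hy1
      _ ≤ 2 ^ tower (d + 1) (2 * (2 * y)) :=
          Real.rpow_le_rpow_of_exponent_le one_le_two (tower_succ_sq_le d (by linarith))
      _ = tower (d + 1 + 1) (3 * 4 ^ (d + 1) * (m * (m + Real.logb 2 r))) := by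
          rw [hy, pow_succ]
          change tower (d + 1 + 1) _ = _
          congr 1
          ring

theorem graphBound_zero : graphBound r m 0 = 1 := rfl

theorem graphBound_succ_le (hr : 1 ≤ r) (d : ℕ) :
    graphBound r m (d + 1) ≤ 2 * typeBound (r * 2 ^ m) m d ^ (m + 1) * graphBound r m d := by
  have : Nonempty (Fin r) := ⟨⟨0, hr⟩⟩
  have hC : Nat.card (Fin r × Set (Fin m)) = r * 2 ^ m := by
    rw [Nat.card_prod, Nat.card_fin, Nat.card_eq_fintype_card, Fintype.card_set, Fintype.card_fin]
  refine Nat.mul_le_mul_right _ ((card_shapeType_mul_threshold_le le_rfl d).trans_eq ?_)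
  rw [hC, threshold]

theorem graphBound_le (hr : 1 ≤ r) (hm : 1 ≤ m) (d : ℕ) :
    (graphBound r m d : ℝ) ≤ tower d (3 * 4 ^ d * (m * (m + Real.logb 2 r))) := by
  have hX := one_le_rank_mul hr hm
  induction d with
  | zero =>
    rw [graphBound_zero]
    change ((1 : ℕ) : ℝ) ≤ 3 * 4 ^ 0 * (m * (m + Real.logb 2 r))
    norm_num
    linarith
  | succ d ih =>
    have h4 : (1 : ℝ) ≤ 4 ^ d := one_le_pow₀ (by norm_num)
    set y : ℝ := 3 * 4 ^ d * (m * (m + Real.logb 2 r)) with hy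
    have hy1 : 1 ≤ y := by nlinarith
    have hpos := one_le_tower (d + 1) hy1
    calc (graphBound r m (d + 1) : ℝ)
        ≤ ((2 * typeBound (r * 2 ^ m) m d ^ (m + 1) * graphBound r m d : ℕ) : ℝ) := by
          exact_mod_cast graphBound_succ_le hr d
      _ = ((2 * typeBound (r * 2 ^ m) m d ^ (m + 1) : ℕ) : ℝ) * graphBound r m d := Nat.cast_mul _ _
      _ ≤ tower (d + 1) y * tower (d + 1) y := by
          gcongr
          · exact two_mul_typeBound_pow_le hr hm d
          · exact ih.trans (tower_le_tower_succ d hy1)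
      _ = tower (d + 1) y ^ 2 := (sq _).symm
      _ ≤ tower (d + 1) (2 * y) := tower_succ_sq_le d hy1
      _ ≤ tower (d + 1) (3 * 4 ^ (d + 1) * (m * (m + Real.logb 2 r))) := by
          refine tower_mono _ ?_
          rw [pow_succ]
          linarith

/-- For `d = 0` this does not follow from `graphBound_le`, the square of whose bound has degree four
in `m`; but then the only graph is a single vertex. -/
theorem graphBound_sq_le (hr : 1 ≤ r) (hm : 1 ≤ m) (d : ℕ) :
    (graphBound r m d : ℝ) ^ 2 ≤ tower d (6 * 4 ^ d * (m * (m + Real.logb 2 r))) := by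
  have hX := one_le_rank_mul hr hm
  have h4 : (1 : ℝ) ≤ 4 ^ d := one_le_pow₀ (by norm_num)
  have hy1 : 1 ≤ 3 * 4 ^ d * (m * (m + Real.logb 2 r)) := by nlinarith
  cases d with
  | zero =>
    rw [graphBound_zero]
    change ((1 : ℕ) : ℝ) ^ 2 ≤ 6 * 4 ^ 0 * (m * (m + Real.logb 2 r))
    norm_num
    linarith
  | succ d =>
    refine (pow_le_pow_left₀ (Nat.cast_nonneg _) (graphBound_le hr hm (d + 1)) 2).trans ?_
    refine (tower_succ_sq_le d hy1).trans_eq ?_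
    congr 1
    ring

end

/-! ### Counting equivalence classes -/

/-- The graph encoded by a set `R` of pairs: its vertices are the elements `a` with `(a, a) ∈ R`. -/
def decodeGraph {A : Type v} (R : Set (A × A)) : SimpleGraph {a // (a, a) ∈ R} :=
  SimpleGraph.fromRel fun a b => ((a : A), (b : A)) ∈ R

theorem exists_decodeGraph_iso {V : Type u} {A : Type v} (G : SimpleGraph V) (f : V ↪ A) :
    ∃ R : Set (A × A), Nonempty (decodeGraph R ≃g G) := by
  let R : Set (A × A) := {z | ∃ a b, (a = b ∨ G.Adj a b) ∧ z = (f a, f b)}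
  have hR (a b) : (f a, f b) ∈ R ↔ a = b ∨ G.Adj a b := by
    constructor
    · rintro ⟨a', b', h, h'⟩
      obtain rfl := f.injective (Prod.mk.inj h').1
      obtain rfl := f.injective (Prod.mk.inj h').2
      exact h
    · exact fun h => ⟨a, b, h, rfl⟩
  let g : V → {a // (a, a) ∈ R} := fun a => ⟨f a, (hR a a).mpr (Or.inl rfl)⟩
  have hg : g.Bijective := by
    constructor
    · exact fun a b h => f.injective (congrArg Subtype.val h)
    · rintro ⟨_, a, b, -, h⟩
      exact ⟨a, Subtype.ext (Prod.mk.inj h).1.symm⟩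
  let iso : G ≃g decodeGraph R :=
    { toEquiv := Equiv.ofBijective g hg
      map_rel_iff' := by
        intro a b
        change (decodeGraph R).Adj (g a) (g b) ↔ G.Adj a b
        rw [decodeGraph, SimpleGraph.fromRel_adj]
        change g a ≠ g b ∧ ((f a, f b) ∈ R ∨ (f b, f a) ∈ R) ↔ _
        rw [hR, hR, hg.1.ne_iff, G.adj_comm b a, eq_comm (a := b)]
        have := G.ne_of_adj (a := a) (b := b)
        tauto }
  exact ⟨R, ⟨iso.symm⟩⟩

/-- If every graph of a class is equivalent to one with at most `M` vertices, then there are at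
most `2 ^ M ^ 2` equivalence classes. -/
theorem finite_msoClasses {C : GraphClass.{u}} {m M : ℕ}
    (h : ∀ (V : Type u) (G : SimpleGraph V), C V G →
      ∃ s : Set V, s.Finite ∧ MSOEquiv m (G.induce s) G ∧ s.ncard ≤ M) :
    Finite (MSOClasses m C) ∧ Nat.card (MSOClasses m C) ≤ 2 ^ M ^ 2 := by
  have key (q : MSOClasses m C) :
      ∃ R : Set (Fin M × Fin M), MSOEquiv m (decodeGraph R) q.out.1.2 := by
    obtain ⟨s, hs, hsG, hsM⟩ := h q.out.1.1 q.out.1.2 q.out.2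
    have := hs.to_subtype
    rw [← Nat.card_coe_set_eq] at hsM
    let f : s ↪ Fin M := (Finite.equivFin s).toEmbedding.trans (Fin.castLEEmb hsM)
    obtain ⟨R, ⟨iso⟩⟩ := exists_decodeGraph_iso (q.out.1.2.induce s) f
    exact ⟨R, fun φ hφ => (MSOEquiv.of_iso iso m φ hφ).trans (hsG φ hφ)⟩
  choose R hR using key
  have hinj : Function.Injective R := by
    intro q q' hqq'
    rw [← Quotient.out_eq q, ← Quotient.out_eq q']
    refine Quotient.sound fun φ hφ => (hR q φ hφ).symm.trans ?_
    rw [hqq']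
    exact hR q' φ hφ
  refine ⟨Finite.of_injective R hinj, (Nat.card_le_card_of_injective R hinj).trans_eq ?_⟩
  rw [Nat.card_eq_fintype_card, Fintype.card_set, Fintype.card_prod, Fintype.card_fin, sq]

/-! ### Pseudo-finiteness and the index of equivalence -/

theorem mainTheorem1 :
    ∃ h : ℕ → ℕ, StrictMono h ∧ ∀ d r : ℕ,
      (∀ m : ℕ, 1 ≤ m →
        (∀ (V : Type u) (G : SimpleGraph V), TM r d V G →
          ∃ s : Set V, s.Finite ∧ TM r d s (G.induce s) ∧ MSOEquiv m (G.induce s) G ∧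
            (s.ncard : ℝ) ≤ tower d ((h d : ℝ) * m * (m + Real.logb 2 r))) ∧
        Finite (MSOClasses m (TM.{u} r d)) ∧
        (Nat.card (MSOClasses m (TM.{u} r d)) : ℝ) ≤
          tower (d + 1) ((h d : ℝ) * (m : ℝ) ^ 2 * (max 1 (Real.logb 2 r)) ^ 2)) ∧
      (∀ (V : Type u) (G : SimpleGraph V), TM r d V G →
        MSOPseudoFinite G (TMFin.{u} r d)) := by
  -- the pruned graphs need only `3 * 4 ^ d`; squaring their size and comparing `m * (m + log r)`
  -- with `2 * m ^ 2 * (max 1 (log r)) ^ 2` cost a factor of two each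
  refine ⟨fun d => 12 * 4 ^ d, ?_, fun d r => ⟨fun m hm => ⟨fun V G hG => ?_, ?_⟩, ?_⟩⟩
  · exact fun a b hab => Nat.mul_lt_mul_of_pos_left (Nat.pow_lt_pow_right (by norm_num) hab)
      (by norm_num)
  · obtain ⟨s, hs, hne, hsG, hcard⟩ := hG.exists_finite_msoEquiv m
    refine ⟨s, hs, hG.induce hne, hsG, ?_⟩
    have hcard' : (s.ncard : ℝ) ≤ graphBound r m d := by exact_mod_cast hcard
    refine (hcard'.trans (graphBound_le hG.pos hm d)).trans (tower_mono d ?_)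
    have hX := one_le_rank_mul hG.pos hm
    have h4 : (1 : ℝ) ≤ 4 ^ d := one_le_pow₀ (by norm_num)
    push_cast
    nlinarith
  · obtain ⟨hfin, hcard⟩ := finite_msoClasses (C := TM.{u} r d) (m := m) (M := graphBound r m d)
      fun V G hG => by
        obtain ⟨s, hs, -, hsG, hcard⟩ := hG.exists_finite_msoEquiv m
        exact ⟨s, hs, hsG, hcard⟩
    refine ⟨hfin, ?_⟩
    rcases isEmpty_or_nonempty (MSOClasses m (TM.{u} r d)) with hE | ⟨⟨q⟩⟩
    · rw [Nat.card_of_isEmpty, Nat.cast_zero]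
      exact Real.rpow_nonneg two_pos.le _
    have hr : 1 ≤ r := q.out.2.pos
    have hcard' : (Nat.card (MSOClasses m (TM.{u} r d)) : ℝ) ≤
        (2 : ℝ) ^ ((graphBound r m d : ℝ) ^ 2) := by
      rw [← Nat.cast_pow, Real.rpow_natCast]
      exact_mod_cast hcard
    refine hcard'.trans (Real.rpow_le_rpow_of_exponent_le one_le_two ?_)
    refine (graphBound_sq_le hr hm d).trans (tower_mono d ?_)
    have h4 : (0 : ℝ) < 4 ^ d := by positivity
    have hm1 : (1 : ℝ) ≤ m := by exact_mod_cast hm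
    set L := max 1 (Real.logb 2 r) with hL
    have hL1 : 1 ≤ L := le_max_left _ _
    have hlL : Real.logb 2 r ≤ L := le_max_right _ _
    have hXL : (m : ℝ) * (m + Real.logb 2 r) ≤ 2 * (m ^ 2 * L ^ 2) := by
      have h1 : (m : ℝ) * (m + Real.logb 2 r) ≤ m * (m + L) := by gcongr
      have h2 : (m : ℝ) ^ 2 * 1 ≤ m ^ 2 * L ^ 2 := by
        gcongr
        exact one_le_pow₀ hL1
      have h3 : (m : ℝ) * L ≤ m ^ 2 * L ^ 2 := by
        rw [← mul_pow]
        exact le_self_pow₀ (one_le_mul_of_one_le_of_one_le hm1 hL1) two_ne_zero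
      nlinarith
    push_cast
    nlinarith
  · intro V G hG φ hφ
    obtain ⟨s, hs, hne, hsG, -⟩ := hG.exists_finite_msoEquiv φ.rank
    exact (hsG φ le_rfl).mp (hφ s _ ⟨hs.to_subtype, hG.induce hne⟩)
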